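/- Let $\mathbb{H}^N$ be the hyperbolic space in the Poincaré ball model: the open unit ball of $\mathbb{R}^N$ with the metric $4|dx|^2/(1-|x|^2)^2$, volume $dV_{\mathbb H}$, gradient $\nabla_{\mathbb H}$, and geodesic distance $\rho(x)$ from $x$ to the centre $O=0$; let $B_R=\{\rho<R\}$, and let $\partial_\rho$ be the derivative along unit speed geodesics starting at $O$. For $\alpha\ge 0$ let $J_\alpha$ be the Bessel function of the first kind and $z_\alpha$ its first positive zero. Let $0\le\alpha\le\frac{N-2}{2}$ (so $N\ge 2$), $R>0$ and $f\in C_0^\infty(B_R)$ real-valued (the support is a compact subset of the open ball $B_R$, and may contain $O$). Put $$\varphi(r)=r^{\frac{2-N}{2}}J_\alpha\Big(\frac{z_\alpha}{R}r\Big),\qquad K(r)=\left(\frac{2-N}{2r}+\frac{z_\alpha}{R}\,\frac{J_\alpha'(\frac{z_\alpha}{R}r)}{J_\alpha(\frac{z_\alpha}{R}r)}\right)\frac{r\cosh r-\sinh r}{r\sinh r}\qquad(0<r<R).$$ Then all integrals below are finite (for $N=2$, where $\frac{(N-2)^2}{4}-\alpha^2=0$, the term with $f^2/\rho^2$ is read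 as $0$), and $$\int_{0<\rho<R}|\nabla_{\mathbb H}f|^2dV_{\mathbb H}-\Big(\frac{(N-2)^2}{4}-\alpha^2\Big)\int_{0<\rho<R}\frac{f^2}{\rho^2}dV_{\mathbb H}=\frac{z_\alpha^2}{R^2}\int_{0<\rho<R}f^2dV_{\mathbb H}+\int_{0<\rho<R}\frac{J_\alpha^2(\frac{z_\alpha}{R}\rho)}{\rho^{N-2}}\Big|\nabla_{\mathbb H}\Big(\frac{f}{\varphi(\rho)}\Big)\Big|^2dV_{\mathbb H}-(N-1)\int_{0<\rho<R}K(\rho)f^2dV_{\mathbb H}.$$ The same identity holds with $\nabla_{\mathbb H}$ replaced by $\partial_\rho$ in both places. Moreover $-(N-1)K(r)\ge 0$ for $0<r<R$, and consequently $$\int_{0<\rho<R}|\nabla_{\mathbb H}f|^2dV_{\mathbb H}\ge\int_{0<\rho<R}|\partial_\rho f|^2dV_{\mathbb H}\ge\Big(\frac{(N-2)^2}{4}-\alpha^2\Big)\int_{0<\rho<R}\frac{f^2}{\rho^2}dV_{\mathbb H}+\frac{z_\alpha^2}{R^2}\int_{0<\rho<R}f^2dV_{\mathbb H}-(N-1)\int_{0<\rho<R}K(\rho)f^2dV_{\mathbb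 H}$$ $$\ge\Big(\frac{(N-2)^2}{4}-\alpha^2\Big)\int_{0<\rho<R}\frac{f^2}{\rho^2}dV_{\mathbb H}+\frac{z_\alpha^2}{R^2}\int_{0<\rho<R}f^2dV_{\mathbb H}.$$ -/

import Mathlib

open Real Set MeasureTheory
open scoped ContDiff

noncomputable section

/-! ## The hyperbolic space in the Poincaré ball model

The underlying set is the open unit ball of `ℝ^N`, with the Riemannian metric
`4 |dx|² / (1 - |x|²)²` of constant curvature `-1`. -/

/-- The Poincaré metric `g_x(v, w)`. -/
def hypMetric {N : ℕ} (x v w : EuclideanSpace ℝ (Fin N)) : ℝ :=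
  4 / (1 - ‖x‖ ^ 2) ^ 2 * inner ℝ v w

/-- The length of a tangent vector `v` at `x`. -/
def hypNorm {N : ℕ} (x v : EuclideanSpace ℝ (Fin N)) : ℝ := √(hypMetric x v v)

/-- The Riemannian volume `(2 / (1 - |x|²))^N dx` on the unit ball. -/
def hypVolume (N : ℕ) : Measure (EuclideanSpace ℝ (Fin N)) :=
  (volume.restrict (Metric.ball 0 1)).withDensity
    fun x => ENNReal.ofReal ((2 / (1 - ‖x‖ ^ 2)) ^ N)

/-- The Riemannian gradient `∇_ℍ f = ((1 - |x|²) / 2)² ∇ f`. -/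
def hypGrad {N : ℕ} (f : EuclideanSpace ℝ (Fin N) → ℝ) (x : EuclideanSpace ℝ (Fin N)) :
    EuclideanSpace ℝ (Fin N) :=
  ((1 - ‖x‖ ^ 2) / 2) ^ 2 • gradient f x

/-- The hyperbolic lengths of the `C¹` curves in the unit ball from `x` to `y`. -/
def hypLengths {N : ℕ} (x y : EuclideanSpace ℝ (Fin N)) : Set ℝ :=
  {L | ∃ γ : ℝ → EuclideanSpace ℝ (Fin N), ContDiffOn ℝ 1 γ (Icc 0 1) ∧
    (∀ t ∈ Icc (0 : ℝ) 1, γ t ∈ Metric.ball 0 1) ∧ γ 0 = x ∧ γ 1 = y ∧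
    L = ∫ t in (0 : ℝ)..1, hypNorm (γ t) (derivWithin γ (Icc 0 1) t)}

/-- The geodesic distance: the infimum of the lengths of curves. -/
def hypDist {N : ℕ} (x y : EuclideanSpace ℝ (Fin N)) : ℝ := sInf (hypLengths x y)

/-- The geodesic distance `ρ(x)` to the centre `O = 0`. -/
def hypRho {N : ℕ} (x : EuclideanSpace ℝ (Fin N)) : ℝ := hypDist 0 x

/-- The open geodesic ball `B_R` with centre `O`. -/
def hypBall (N : ℕ) (R : ℝ) : Set (EuclideanSpace ℝ (Fin N)) :=
  {x | x ∈ Metric.ball 0 1 ∧ hypRho x < R}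

/-- The punctured geodesic ball `{0 < ρ < R}`. -/
def hypPuncturedBall (N : ℕ) (R : ℝ) : Set (EuclideanSpace ℝ (Fin N)) :=
  {x | x ∈ Metric.ball 0 1 ∧ 0 < hypRho x ∧ hypRho x < R}

/-- The unit speed geodesic starting at `O` in the direction of the Euclidean unit vector `u`
(see `hypNorm_deriv_hypRay` and `hypRho_hypRay` below). -/
def hypRay {N : ℕ} (u : EuclideanSpace ℝ (Fin N)) (t : ℝ) : EuclideanSpace ℝ (Fin N) :=
  tanh (t / 2) • u

/-- The radial derivative `∂_ρ f (x)`: the derivative of `f` along the unit speed geodesic from `O`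
through `x`, at the time `ρ(x)` at which it passes through `x` (see `hypRay_hypRho`). -/
def radialDeriv {N : ℕ} (f : EuclideanSpace ℝ (Fin N) → ℝ) (x : EuclideanSpace ℝ (Fin N)) : ℝ :=
  deriv (fun t => f (hypRay (‖x‖⁻¹ • x) t)) (hypRho x)

/-! ## Bessel functions of the first kind -/

/-- `J_α(x) = ∑ (-1)^m / (m! Γ(m + α + 1)) (x / 2)^(2 m + α)`, for `α ≥ 0` and `x ≥ 0`. -/
def besselJ (α x : ℝ) : ℝ :=
  ∑' m : ℕ, (-1 : ℝ) ^ m / (m.factorial * Gamma (m + α + 1)) * (x / 2) ^ (2 * (m : ℝ) + α)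

/-- The first positive zero `z_α` of `J_α`. -/
def besselZero (α : ℝ) : ℝ := sInf {x | 0 < x ∧ besselJ α x = 0}

/-! ## The weights of the identity -/

/-- `φ(r) = r^((2 - N) / 2) J_α(z_α r / R)`. -/
def bvProfile (N : ℕ) (α R r : ℝ) : ℝ :=
  r ^ ((2 - (N : ℝ)) / 2) * besselJ α (besselZero α / R * r)

/-- `((2 - N) / (2 r) + (z_α / R) J_α'(z_α r / R) / J_α(z_α r / R)) *
(r cosh r - sinh r) / (r sinh r)`. -/
def bvKernel (N : ℕ) (α R r : ℝ) : ℝ :=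
  ((2 - (N : ℝ)) / (2 * r) + besselZero α / R *
      (deriv (besselJ α) (besselZero α / R * r) / besselJ α (besselZero α / R * r))) *
    ((r * cosh r - sinh r) / (r * sinh r))

/-! ## Sanity facts on the model -/

/-- The defining property of the Riemannian gradient. -/
theorem hypMetric_hypGrad {N : ℕ} (f : EuclideanSpace ℝ (Fin N) → ℝ)
    {x : EuclideanSpace ℝ (Fin N)} (hx : x ∈ Metric.ball 0 1) (v : EuclideanSpace ℝ (Fin N)) :
    hypMetric x (hypGrad f x) v = fderiv ℝ f x v := by
  have h1 : ‖x‖ < 1 := by simpa using hx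
  have h2 : 1 - ‖x‖ ^ 2 ≠ 0 := by nlinarith [norm_nonneg x]
  have h3 : inner ℝ (gradient f x) v = fderiv ℝ f x v := by
    simp [gradient]
  rw [hypMetric, hypGrad, real_inner_smul_left, h3]
  field_simp
  norm_num

theorem hypNorm_eq {N : ℕ} {x : EuclideanSpace ℝ (Fin N)} (hx : x ∈ Metric.ball 0 1)
    (v : EuclideanSpace ℝ (Fin N)) : hypNorm x v = 2 / (1 - ‖x‖ ^ 2) * ‖v‖ := by
  have h1 : ‖x‖ < 1 := by simpa using hx
  have h2 : 0 < 1 - ‖x‖ ^ 2 := by nlinarith [norm_nonneg x]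
  rw [hypNorm, hypMetric, real_inner_self_eq_norm_sq]
  rw [show 4 / (1 - ‖x‖ ^ 2) ^ 2 * ‖v‖ ^ 2 = (2 / (1 - ‖x‖ ^ 2) * ‖v‖) ^ 2 by
    field_simp; ring]
  exact Real.sqrt_sq (by positivity)

theorem hasDerivAt_logRatio {s : ℝ} (h1 : -1 < s) (h2 : s < 1) :
    HasDerivAt (fun s : ℝ => log (1 + s) - log (1 - s)) (2 / (1 - s ^ 2)) s := by
  have ha : HasDerivAt (fun s : ℝ => log (1 + s)) (1 / (1 + s)) s :=
    ((hasDerivAt_id s).const_add 1).log (by simp; linarith)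
  have hb : HasDerivAt (fun s : ℝ => log (1 - s)) (-1 / (1 - s)) s :=
    ((hasDerivAt_id s).const_sub 1).log (by simp; linarith)
  have h3 : (1 : ℝ) + s ≠ 0 := by linarith
  have h4 : (1 : ℝ) - s ≠ 0 := by linarith
  have h5 : 1 - s ^ 2 ≠ 0 := by
    rw [show 1 - s ^ 2 = (1 + s) * (1 - s) by ring]; exact mul_ne_zero h3 h4
  have he : 2 / (1 - s ^ 2) = 1 / (1 + s) - -1 / (1 - s) := by
    rw [div_sub_div _ _ h3 h4, show (1 + s) * (1 - s) = 1 - s ^ 2 by ring]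
    congr 1; ring
  rw [he]
  exact ha.sub hb

/-- In the ball model, `ρ(x) = log ((1 + |x|) / (1 - |x|))`. -/
theorem hypRho_eq {N : ℕ} {x : EuclideanSpace ℝ (Fin N)} (hx : x ∈ Metric.ball 0 1) :
    hypRho x = log ((1 + ‖x‖) / (1 - ‖x‖)) := by
  have hx1 : ‖x‖ < 1 := by simpa using hx
  have hx0 := norm_nonneg x
  rw [log_div (by linarith) (by linarith)]
  refine IsLeast.csInf_eq ⟨?_, ?_⟩
  · -- the straight segment
    refine ⟨fun t => t • x, by fun_prop, ?_, by simp, by simp, ?_⟩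
    · rintro t ⟨h0, h1⟩
      simp only [mem_ball_zero_iff, norm_smul, Real.norm_eq_abs, abs_of_nonneg h0]
      nlinarith
    · have key : ∫ t in (0 : ℝ)..1, hypNorm (t • x) (derivWithin (fun t : ℝ => t • x) (Icc 0 1) t)
          = ∫ t in (0 : ℝ)..1, 2 / (1 - (t * ‖x‖) ^ 2) * ‖x‖ := by
        refine intervalIntegral.integral_congr fun t ht => ?_
        rw [uIcc_of_le zero_le_one] at ht
        have hd : HasDerivWithinAt (fun t : ℝ => t • x) x (Icc 0 1) t := by
          simpa using ((hasDerivAt_id t).smul_const x).hasDerivWithinAt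
        have hb : t • x ∈ Metric.ball (0 : EuclideanSpace ℝ (Fin N)) 1 := by
          simp only [mem_ball_zero_iff, norm_smul, Real.norm_eq_abs, abs_of_nonneg ht.1]
          nlinarith [ht.2]
        rw [hd.derivWithin (uniqueDiffOn_Icc_zero_one t ht), hypNorm_eq hb, norm_smul,
          Real.norm_eq_abs, abs_of_nonneg ht.1]
      rw [key, intervalIntegral.integral_eq_sub_of_hasDerivAt
        (f := fun t => log (1 + t * ‖x‖) - log (1 - t * ‖x‖))]
      · simp
      · intro t ht
        rw [uIcc_of_le zero_le_one] at ht
        have h1 : HasDerivAt (fun t : ℝ => t * ‖x‖) ‖x‖ t := by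
          simpa using (hasDerivAt_id t).mul_const ‖x‖
        exact (hasDerivAt_logRatio (by nlinarith [ht.1]) (by nlinarith [ht.2])).comp t h1
      · refine ContinuousOn.intervalIntegrable ?_
        rw [uIcc_of_le zero_le_one]
        refine ContinuousOn.mul (ContinuousOn.div continuousOn_const (by fun_prop) ?_)
          continuousOn_const
        intro t ht
        have : t * ‖x‖ < 1 := by nlinarith [ht.2]
        have : 0 ≤ t * ‖x‖ := mul_nonneg ht.1 hx0
        nlinarith
  · rintro L ⟨γ, hγ, hb, h0, h1, rfl⟩
    have hdc : ContinuousOn (derivWithin γ (Icc 0 1)) (Icc 0 1) :=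
      hγ.continuousOn_derivWithin (uniqueDiffOn_Icc zero_lt_one) le_rfl
    set e : EuclideanSpace ℝ (Fin N) := ‖x‖⁻¹ • x with he
    have hen : ‖e‖ ≤ 1 := by
      rw [he, norm_smul, norm_inv, norm_norm]; exact inv_mul_le_one
    set h : ℝ → ℝ := fun t => inner ℝ e (γ t) with hh
    have hle : ∀ v : EuclideanSpace ℝ (Fin N), |inner ℝ e v| ≤ ‖v‖ := fun v =>
      (abs_real_inner_le_norm e v).trans (mul_le_of_le_one_left (norm_nonneg v) hen)
    have hlt : ∀ t ∈ Icc (0 : ℝ) 1, |h t| ≤ ‖γ t‖ ∧ ‖γ t‖ < 1 := fun t ht =>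
      ⟨hle _, by simpa using hb t ht⟩
    have hcont : ContinuousOn h (Icc 0 1) := continuousOn_const.inner hγ.continuousOn
    have hden : ∀ t ∈ Icc (0 : ℝ) 1, 0 < 1 - ‖γ t‖ ^ 2 ∧ ‖γ t‖ ^ 2 ≥ h t ^ 2 := fun t ht => by
      obtain ⟨ha, hb⟩ := hlt t ht
      refine ⟨by nlinarith [norm_nonneg (γ t)], ?_⟩
      rw [ge_iff_le, ← sq_abs (h t)]
      exact pow_le_pow_left₀ (abs_nonneg _) ha 2
    have hci : ContinuousOn (fun t => 2 / (1 - h t ^ 2) *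
        inner ℝ e (derivWithin γ (Icc 0 1) t)) (Icc 0 1) := by
      refine ContinuousOn.mul (ContinuousOn.div continuousOn_const (by fun_prop) ?_)
        (continuousOn_const.inner hdc)
      intro t ht
      have := hden t ht
      linarith [this.1, this.2]
    have hcr : ContinuousOn (fun t => 2 / (1 - ‖γ t‖ ^ 2) *
        ‖derivWithin γ (Icc 0 1) t‖) (Icc 0 1) := by
      refine ContinuousOn.mul (ContinuousOn.div continuousOn_const
        (continuousOn_const.sub (hγ.continuousOn.norm.pow 2)) ?_) hdc.norm
      intro t ht
      exact (hden t ht).1.ne'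
    have key : ∫ t in (0 : ℝ)..1, 2 / (1 - h t ^ 2) * inner ℝ e (derivWithin γ (Icc 0 1) t)
        = log (1 + ‖x‖) - log (1 - ‖x‖) := by
      rw [intervalIntegral.integral_eq_sub_of_hasDerivAt_of_le zero_le_one
        (f := fun t => log (1 + h t) - log (1 - h t))]
      · have e1 : h 1 = ‖x‖ := by
          simp only [hh, h1, he, real_inner_smul_left, real_inner_self_eq_norm_sq]
          rcases eq_or_ne ‖x‖ 0 with h | h
          · simp [h]
          · field_simp
        have e0 : h 0 = 0 := by simp [hh, h0]
        simp [e1, e0]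
      · refine ContinuousOn.sub (ContinuousOn.log (by fun_prop) ?_)
          (ContinuousOn.log (by fun_prop) ?_)
        · intro t ht
          have := abs_lt.1 ((hlt t ht).1.trans_lt (hlt t ht).2)
          linarith [this.1]
        · intro t ht
          have := abs_lt.1 ((hlt t ht).1.trans_lt (hlt t ht).2)
          linarith [this.2]
      · intro t ht
        have ht' := Ioo_subset_Icc_self ht
        have hab := abs_lt.1 ((hlt t ht').1.trans_lt (hlt t ht').2)
        have hd : HasDerivAt γ (derivWithin γ (Icc 0 1) t) t :=
          (((hγ.differentiableOn one_ne_zero) t ht').hasDerivWithinAt).hasDerivAt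
            (Icc_mem_nhds ht.1 ht.2)
        have hd2 : HasDerivAt h (inner ℝ e (derivWithin γ (Icc 0 1) t)) t := by
          simpa using (hasDerivAt_const t e).inner ℝ hd
        exact (hasDerivAt_logRatio hab.1 hab.2).comp t hd2
      · refine ContinuousOn.intervalIntegrable ?_
        rwa [uIcc_of_le zero_le_one]
    rw [← key]
    have hcongr : ∫ t in (0 : ℝ)..1, hypNorm (γ t) (derivWithin γ (Icc 0 1) t)
        = ∫ t in (0 : ℝ)..1, 2 / (1 - ‖γ t‖ ^ 2) * ‖derivWithin γ (Icc 0 1) t‖ := by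
      refine intervalIntegral.integral_congr fun t ht => ?_
      rw [uIcc_of_le zero_le_one] at ht
      exact hypNorm_eq (hb t ht) _
    rw [hcongr]
    refine intervalIntegral.integral_mono_on zero_le_one ?_ ?_ ?_
    · refine ContinuousOn.intervalIntegrable ?_
      rwa [uIcc_of_le zero_le_one]
    · refine ContinuousOn.intervalIntegrable ?_
      rwa [uIcc_of_le zero_le_one]
    · intro t ht
      obtain ⟨ha, hb⟩ := hden t ht
      have hc := (le_abs_self _).trans (hle (derivWithin γ (Icc 0 1) t))
      calc 2 / (1 - h t ^ 2) * inner ℝ e (derivWithin γ (Icc 0 1) t)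
          ≤ 2 / (1 - h t ^ 2) * ‖derivWithin γ (Icc 0 1) t‖ :=
            mul_le_mul_of_nonneg_left hc (by
              have : 0 < 1 - h t ^ 2 := by linarith
              positivity)
        _ ≤ 2 / (1 - ‖γ t‖ ^ 2) * ‖derivWithin γ (Icc 0 1) t‖ := by
            gcongr

theorem log_ratio_tanh (t : ℝ) : log ((1 + tanh (t / 2)) / (1 - tanh (t / 2))) = t := by
  have hc := cosh_pos (t / 2)
  have h1 : 1 + tanh (t / 2) = exp (t / 2) / cosh (t / 2) := by
    rw [tanh_eq_sinh_div_cosh, ← cosh_add_sinh]; field_simp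
  have h2 : 1 - tanh (t / 2) = exp (-(t / 2)) / cosh (t / 2) := by
    rw [tanh_eq_sinh_div_cosh, ← cosh_sub_sinh]; field_simp
  rw [h1, h2, div_div_div_cancel_right₀ hc.ne', ← exp_sub, log_exp]
  ring

theorem hypRay_mem {N : ℕ} {u : EuclideanSpace ℝ (Fin N)} (hu : ‖u‖ = 1) (t : ℝ) :
    hypRay u t ∈ Metric.ball (0 : EuclideanSpace ℝ (Fin N)) 1 := by
  simp [hypRay, norm_smul, hu, abs_tanh_lt_one]

/-- The rays from `O` are minimizing: the distance from `O` is the time parameter. -/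
theorem hypRho_hypRay {N : ℕ} {u : EuclideanSpace ℝ (Fin N)} (hu : ‖u‖ = 1) {t : ℝ} (ht : 0 ≤ t) :
    hypRho (hypRay u t) = t := by
  have h0 : 0 ≤ tanh (t / 2) := by
    rw [tanh_eq_sinh_div_cosh]
    exact div_nonneg (sinh_nonneg_iff.2 (by linarith)) (cosh_pos _).le
  rw [hypRho_eq (hypRay_mem hu t), hypRay, norm_smul, hu, mul_one, Real.norm_eq_abs,
    abs_of_nonneg h0, log_ratio_tanh]

/-- The rays from `O` have unit speed. -/
theorem hypNorm_deriv_hypRay {N : ℕ} {u : EuclideanSpace ℝ (Fin N)} (hu : ‖u‖ = 1) (t : ℝ) :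
    hypNorm (hypRay u t) (deriv (hypRay u) t) = 1 := by
  have hc := cosh_pos (t / 2)
  have hs := cosh_sq_sub_sinh_sq (t / 2)
  have hh : HasDerivAt (fun t : ℝ => t / 2) (1 / 2) t := (hasDerivAt_id t).div_const 2
  have hd : HasDerivAt (fun t : ℝ => tanh (t / 2)) (1 / (2 * cosh (t / 2) ^ 2)) t := by
    simp_rw [tanh_eq_sinh_div_cosh]
    have he : 1 / (2 * cosh (t / 2) ^ 2) = (cosh (t / 2) * (1 / 2) * cosh (t / 2) -
        sinh (t / 2) * (sinh (t / 2) * (1 / 2))) / cosh (t / 2) ^ 2 := by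
      field_simp
      linarith
    rw [he]
    exact hh.sinh.div hh.cosh hc.ne'
  have hd2 : deriv (hypRay u) t = (1 / (2 * cosh (t / 2) ^ 2)) • u := (hd.smul_const u).deriv
  rw [hd2, hypNorm_eq (hypRay_mem hu t), hypRay, norm_smul, norm_smul, hu, mul_one, mul_one,
    Real.norm_eq_abs, Real.norm_eq_abs, sq_abs, abs_of_pos (by positivity), tanh_eq_sinh_div_cosh]
  have : 1 - (sinh (t / 2) / cosh (t / 2)) ^ 2 = 1 / cosh (t / 2) ^ 2 := by
    field_simp
    linarith
  rw [this]
  field_simp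

/-- The ray from `O` in the direction of `x` passes through `x` at time `ρ(x)`. -/
theorem hypRay_hypRho {N : ℕ} {x : EuclideanSpace ℝ (Fin N)} (hx : x ∈ Metric.ball 0 1) :
    hypRay (‖x‖⁻¹ • x) (hypRho x) = x := by
  have hx1 : ‖x‖ < 1 := by simpa using hx
  have hx0 := norm_nonneg x
  have h1 : (0 : ℝ) < 1 - ‖x‖ := by linarith
  have hq : 0 < (1 + ‖x‖) / (1 - ‖x‖) := by positivity
  have ht : tanh (log ((1 + ‖x‖) / (1 - ‖x‖)) / 2) = ‖x‖ := by
    set l := log ((1 + ‖x‖) / (1 - ‖x‖)) with hl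
    have he : exp (l / 2) ^ 2 = (1 + ‖x‖) / (1 - ‖x‖) := by
      rw [← exp_nat_mul, hl]; push_cast
      rw [mul_div_cancel₀ _ (two_ne_zero), exp_log hq]
    have hp := exp_pos (l / 2)
    rw [tanh_eq_sinh_div_cosh, sinh_eq, cosh_eq, exp_neg]
    rw [eq_div_iff h1.ne'] at he
    have : exp (l / 2) + (exp (l / 2))⁻¹ ≠ 0 := by positivity
    field_simp
    linarith
  rw [hypRho_eq hx, hypRay, ht, smul_smul]
  rcases eq_or_ne x 0 with h | h
  · simp [h]
  · rw [mul_inv_cancel₀ (norm_ne_zero_iff.2 h), one_smul]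

end

noncomputable section

open Filter Topology

/-! The proof is a ground state substitution. Put ψ = φ'/φ and c = (N-2)²/4 - α². Bessel's equation
says that φ solves the Euclidean radial equation φ'' + (N-1)/r φ' + (z_α²/R² + c/r²) φ = 0, so ψ
satisfies the Riccati equation ψ' = -ψ² - (N-1)/r ψ - z_α²/R² - c/r² (`hasDerivAt_bvLogDeriv`). The
hyperbolic volume has radial density sinh^(N-1) r, whose logarithmic derivative is (N-1) coth r
instead of (N-1)/r. Differentiating the flux sinh^(N-1) r · ψ f² along a ray and completing the
square (∂_ρ f - ψ f)² therefore gives exactly the difference of the two sides of the radial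
identity; the mismatch coth r - 1/r, multiplied by ψ, is K (`hasDerivAt_bvFlux`).

The flux vanishes near ρ = R because f has compact support, and at the centre because sinh^(N-1)
beats the singularity of ψ. That singularity is at most 1/r, and it is absent for N = 2, where α =
0. Hence the defect integrates to zero on every ray, and by polar coordinates on the ball
(`integral_bvDefect`).

Since φ is radial, dividing by it alters only the radial component of the gradient: |∇f|² - (∂_ρ f)²
appears equally on both sides, and the gradient identity follows from the radial one
(`hypNorm_hypGrad_div_bvProfile`).

For the sign of K, coth r - 1/r ≥ 0, while ψ ≤ 0 because α ≤ (N-2)/2 and J_(α+1) ≥ 0 before the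
first zero of J_α (`besselE_succ_nonneg`). The existence of that zero is proved by a concavity
argument (`exists_besselE_eq_zero`). -/

/-! ## The entire function `J_α(x) (x / 2)^(-α)` as a function of `x² / 4` -/

/-- The coefficients of `besselE`. -/
def besselCoeff (a : ℝ) (m : ℕ) : ℝ := (-1 : ℝ) ^ m / (m.factorial * Gamma (m + a + 1))

/-- The entire function with `J_a(x) = (x / 2)^a * besselE a (x² / 4)`. -/
def besselE (a y : ℝ) : ℝ := ∑' m : ℕ, besselCoeff a m * y ^ m

/-- Each unit step multiplies Gamma by a factor m + a + 1 ≥ 1. Only integer shifts are compared,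
since Gamma itself is not monotone near 1. -/
theorem Gamma_le_Gamma_nat_add {a : ℝ} (ha : 0 ≤ a) (m : ℕ) :
    Gamma (a + 1) ≤ Gamma (m + a + 1) := by
  induction m with
  | zero => simp
  | succ m ih =>
    have h : (0 : ℝ) < m + a + 1 := by positivity
    rw [show ((m + 1 : ℕ) : ℝ) + a + 1 = (m + a + 1) + 1 by push_cast; ring, Gamma_add_one h.ne']
    have := Gamma_pos_of_pos h
    nlinarith [(Nat.cast_nonneg m : (0 : ℝ) ≤ m)]

theorem abs_besselCoeff_le {a : ℝ} (ha : 0 ≤ a) (m : ℕ) :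
    |besselCoeff a m| ≤ (Gamma (a + 1))⁻¹ * (m.factorial : ℝ)⁻¹ := by
  have h0 : 0 < Gamma (a + 1) := Gamma_pos_of_pos (by linarith)
  have h1 := Gamma_le_Gamma_nat_add ha m
  have h2 : (0 : ℝ) < m.factorial := by positivity
  rw [besselCoeff, abs_div, abs_pow, abs_neg, abs_one, one_pow,
    abs_of_pos (mul_pos h2 (h0.trans_le h1)), one_div, mul_inv, mul_comm]
  gcongr

theorem summable_besselE {a : ℝ} (ha : 0 ≤ a) (y : ℝ) :
    Summable fun m : ℕ => besselCoeff a m * y ^ m := by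
  refine Summable.of_norm_bounded (g := fun m : ℕ => (Gamma (a + 1))⁻¹ * (|y| ^ m / m.factorial))
    ((Real.summable_pow_div_factorial |y|).mul_left _) fun m => ?_
  rw [norm_mul, norm_pow, Real.norm_eq_abs, Real.norm_eq_abs]
  calc |besselCoeff a m| * |y| ^ m ≤ (Gamma (a + 1))⁻¹ * (m.factorial : ℝ)⁻¹ * |y| ^ m := by
        gcongr; exact abs_besselCoeff_le ha m
    _ = _ := by ring

/-- Coefficient form of E_a' = -E_(a+1): the index shift in m is absorbed by the Gamma factor. -/
theorem besselCoeff_succ (a : ℝ) (m : ℕ) :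
    ((m : ℝ) + 1) * besselCoeff a (m + 1) = -besselCoeff (a + 1) m := by
  simp only [besselCoeff, Nat.factorial_succ]
  push_cast
  rw [show (m : ℝ) + 1 + a + 1 = m + (a + 1) + 1 by ring, pow_succ, mul_assoc, ← mul_div_assoc,
    mul_div_mul_left _ _ (by positivity)]
  ring

/-- Termwise differentiation on a ball around 0 that contains y; the dominating series is the
absolutely convergent series of E_(a+1) at |y| + 1. -/
theorem hasDerivAt_besselE {a : ℝ} (ha : 0 ≤ a) (y : ℝ) :
    HasDerivAt (besselE a) (-besselE (a + 1) y) y := by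
  have ha1 : 0 ≤ a + 1 := by linarith
  set Y : ℝ := |y| + 1 with hY
  have hY0 : 0 ≤ Y := by positivity
  have hu : Summable fun m : ℕ => |besselCoeff a m| * (m * Y ^ (m - 1)) := by
    rw [← summable_nat_add_iff 1]
    have := (summable_besselE ha1 Y).norm
    refine this.congr fun m => ?_
    have h := congrArg abs (besselCoeff_succ a m)
    rw [abs_mul, abs_neg, abs_of_nonneg (by positivity)] at h
    rw [norm_mul, Real.norm_eq_abs, ← h, Real.norm_eq_abs, abs_of_nonneg (pow_nonneg hY0 _)]
    push_cast
    ring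
  have hd := hasDerivAt_tsum_of_isPreconnected (𝕜 := ℝ)
    (g := fun (m : ℕ) (y : ℝ) => besselCoeff a m * y ^ m)
    (g' := fun (m : ℕ) (y : ℝ) => besselCoeff a m * (m * y ^ (m - 1))) (t := Metric.ball 0 Y)
    (y₀ := y) (y := y) hu Metric.isOpen_ball (convex_ball 0 Y).isPreconnected
    (fun m x _ => (hasDerivAt_pow m x).const_mul _)
    (fun m x hx => by
      have hx' : |x| ≤ Y := by simpa using (mem_ball_zero_iff.1 hx).le
      rw [norm_mul, norm_mul, norm_pow, Real.norm_eq_abs, Real.norm_eq_abs, Real.norm_eq_abs,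
        abs_of_nonneg (Nat.cast_nonneg (α := ℝ) m)]
      gcongr)
    (by simp [hY]) (summable_besselE ha y) (by simp [hY])
  refine hd.congr_deriv ?_
  have hs : Summable fun m : ℕ => besselCoeff a m * (m * y ^ (m - 1)) := by
    refine Summable.of_norm_bounded hu fun m => ?_
    rw [norm_mul, norm_mul, norm_pow, Real.norm_eq_abs, Real.norm_eq_abs, Real.norm_eq_abs,
        abs_of_nonneg (Nat.cast_nonneg (α := ℝ) m)]
    gcongr
    simp [hY]
  rw [hs.tsum_eq_zero_add, besselE, ← tsum_neg]
  simp only [Nat.cast_zero, zero_mul, mul_zero, zero_add]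
  refine tsum_congr fun m => ?_
  rw [← neg_mul, ← besselCoeff_succ]
  push_cast
  ring

theorem continuous_besselE {a : ℝ} (ha : 0 ≤ a) : Continuous (besselE a) :=
  continuous_iff_continuousAt.2 fun y => (hasDerivAt_besselE ha y).continuousAt

theorem besselE_zero (a : ℝ) : besselE a 0 = (Gamma (a + 1))⁻¹ := by
  rw [besselE, tsum_eq_single 0 fun m hm => by simp [hm]]
  simp [besselCoeff]

theorem besselCoeff_add_one {a : ℝ} (ha : 0 ≤ a) (m : ℕ) :
    (m + a + 1) * besselCoeff (a + 1) m = besselCoeff a m := by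
  have h : (0 : ℝ) < m + a + 1 := by positivity
  have h2 := (Gamma_pos_of_pos h).ne'
  simp only [besselCoeff]
  rw [show (m : ℝ) + (a + 1) + 1 = (m + a + 1) + 1 by ring, Gamma_add_one h.ne']
  field_simp

/-- Bessel's equation, as a recurrence. -/
theorem besselE_recurrence {a : ℝ} (ha : 0 ≤ a) (y : ℝ) :
    y * besselE (a + 1 + 1) y - (a + 1) * besselE (a + 1) y + besselE a y = 0 := by
  have h0 := (summable_besselE ha y).hasSum
  have h1 := (summable_besselE (a := a + 1) (by linarith) y).hasSum.mul_left (a + 1)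
  have h2 := (summable_besselE (a := a + 1 + 1) (by linarith) y).hasSum.mul_left y
  have h3 : HasSum (fun m : ℕ => -((m : ℝ) * besselCoeff (a + 1) m * y ^ m))
      (y * besselE (a + 1 + 1) y) := by
    -- The term m = 0 vanishes, so multiplication by y is a shift of the index; all three series
    -- then carry the same power y ^ m.
    rw [← hasSum_nat_add_iff' 1]
    simp only [Finset.range_one, Finset.sum_singleton, Nat.cast_zero, zero_mul, neg_zero, sub_zero]
    refine h2.congr_fun fun m => ?_
    have := besselCoeff_succ (a + 1) m
    push_cast
    rw [this]
    ring
  have h4 := (h3.sub h1).add h0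
  refine h4.unique ?_
  convert hasSum_zero using 2 with m
  rw [← besselCoeff_add_one ha m]
  ring

theorem besselJ_eq {a x : ℝ} (hx : 0 < x) :
    besselJ a x = (x / 2) ^ a * besselE a (x ^ 2 / 4) := by
  rw [besselJ, besselE, ← tsum_mul_left]
  refine tsum_congr fun m => ?_
  have h : (0 : ℝ) < x / 2 := by positivity
  rw [rpow_add h, besselCoeff, rpow_mul h.le, rpow_two, rpow_natCast,
    show (x / 2) ^ 2 = x ^ 2 / 4 by ring]
  ring

/-! ### The first positive zero of J_α -/

/-- `besselE a` has a positive zero: otherwise `j = y^(a/2) besselE a y`, a solution of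
`y (y j')' = (a² / 4 - y) j`, would be positive and eventually concave in `log y`. -/
theorem exists_besselE_eq_zero {a : ℝ} (ha : 0 ≤ a) : ∃ y, 0 < y ∧ besselE a y = 0 := by
  by_contra! hne
  have hE0 : 0 < besselE a 0 := by
    rw [besselE_zero]; exact inv_pos.2 (Gamma_pos_of_pos (by linarith))
  have hpos : ∀ y, 0 < y → 0 < besselE a y := by
    intro y hy
    by_contra! h
    obtain ⟨w, hw, hw0⟩ := intermediate_value_Icc' hy.le (continuous_besselE ha).continuousOn
      (⟨h, hE0.le⟩ : (0 : ℝ) ∈ Icc (besselE a y) (besselE a 0))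
    rcases hw.1.eq_or_lt with h' | h'
    · rw [← h'] at hw0; exact hE0.ne' hw0
    · exact hne w h' hw0
  set j : ℝ → ℝ := fun y => y ^ (a / 2) * besselE a y with hj
  set p : ℝ → ℝ := fun y => y ^ (a / 2) * (a / 2 * besselE a y - y * besselE (a + 1) y) with hp
  have hjpos : ∀ y, 0 < y → 0 < j y := fun y hy => mul_pos (rpow_pos_of_pos hy _) (hpos y hy)
  have hpow : ∀ y : ℝ, 0 < y → HasDerivAt (fun y : ℝ => y ^ (a / 2)) (a / 2 * y ^ (a / 2) / y) y := by
    intro y hy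
    have := Real.hasDerivAt_rpow_const (x := y) (p := a / 2) (Or.inl hy.ne')
    rwa [rpow_sub_one hy.ne', ← mul_div_assoc] at this
  have hdj : ∀ y, 0 < y → HasDerivAt j (p y / y) y := by
    intro y hy
    refine ((hpow y hy).mul (hasDerivAt_besselE ha y)).congr_deriv ?_
    simp only [hp]; field_simp; ring
  have hdp : ∀ y, 0 < y → HasDerivAt p ((a ^ 2 / 4 / y - 1) * j y) y := by
    intro y hy
    have h1 := hasDerivAt_besselE (a := a + 1) (by linarith) y
    refine ((hpow y hy).mul (((hasDerivAt_besselE ha y).const_mul (a / 2)).sub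
      ((hasDerivAt_id y).mul h1))).congr_deriv ?_
    have := besselE_recurrence ha y
    simp only [hj, Pi.sub_apply, Pi.mul_apply, id]
    rw [← sub_eq_zero, ← mul_zero (y ^ (a / 2)), ← this]
    field_simp
    ring
  -- For y ≥ a²/2 the coefficient a²/(4y) - 1 is at most -1/2; the added 1 keeps Y positive when a =
  -- 0.
  set Y : ℝ := a ^ 2 / 2 + 1 with hYdef
  have hY : 0 < Y := by positivity
  have hIci : ∀ y ∈ Ici Y, 0 < y := fun y hy => hY.trans_le hy
  have hdp' : ∀ y ∈ Ici Y, (a ^ 2 / 4 / y - 1) * j y ≤ -(j y / 2) := by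
    intro y hy
    have h1 : a ^ 2 / 4 / y ≤ 1 / 2 := by
      rw [div_le_iff₀ (hIci y hy)]
      have : Y ≤ y := hy
      linarith
    nlinarith [hjpos y (hIci y hy)]
  have hpanti : AntitoneOn p (Ici Y) := by
    refine antitoneOn_of_hasDerivWithinAt_nonpos (convex_Ici Y)
      (fun y hy => (hdp y (hIci y hy)).continuousAt.continuousWithinAt)
      (fun y hy => (hdp y (hIci y (interior_subset hy))).hasDerivWithinAt) fun y hy => ?_
    have := hdp' y (interior_subset hy)
    linarith [hjpos y (hIci y (interior_subset hy))]
  -- Here p = y j' is the slope of j in the variable log y, and it decreases beyond Y. If it is ever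
  -- negative, j lies below a falling line in log y. Otherwise j increases, so p' ≤ -j(Y)/2 forces p
  -- below zero.
  by_cases hneg : ∃ y ∈ Ici Y, p y < 0
  · obtain ⟨y₁, hy₁, hp₁⟩ := hneg
    have h1 : 0 < y₁ := hIci y₁ hy₁
    have hIci' : ∀ y ∈ Ici y₁, 0 < y := fun y hy => h1.trans_le hy
    have hanti : AntitoneOn (fun y => j y - p y₁ * log y) (Ici y₁) := by
      have hd : ∀ y ∈ Ici y₁, HasDerivAt (fun y => j y - p y₁ * log y) (p y / y - p y₁ * y⁻¹) y :=
        fun y hy => (hdj y (hIci' y hy)).sub ((hasDerivAt_log (hIci' y hy).ne').const_mul _)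
      refine antitoneOn_of_hasDerivWithinAt_nonpos (convex_Ici y₁)
        (fun y hy => (hd y hy).continuousAt.continuousWithinAt)
        (fun y hy => (hd y (interior_subset hy)).hasDerivWithinAt) fun y hy => ?_
      have hy' : y ∈ Ici y₁ := interior_subset hy
      rw [← div_eq_mul_inv, ← sub_div]
      refine div_nonpos_of_nonpos_of_nonneg ?_ (hIci' y hy').le
      linarith [hpanti hy₁ (mem_Ici.2 ((mem_Ici.1 hy₁).trans hy')) hy']
    -- At log y = log y₁ + s the line with slope p y₁ reaches zero.
    set s : ℝ := j y₁ / -p y₁ with hs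
    have hs0 : 0 < s := div_pos (hjpos y₁ h1) (by linarith)
    have hle : y₁ ≤ y₁ * exp s := le_mul_of_one_le_right h1.le (one_le_exp hs0.le)
    have h2 := hanti self_mem_Ici (mem_Ici.2 hle) hle
    simp only at h2
    rw [log_mul h1.ne' (exp_pos s).ne', log_exp] at h2
    have h3 : p y₁ * s = -j y₁ := by
      rw [hs]; field_simp [hp₁.ne]
    have h4 := hjpos _ (h1.trans_le hle)
    nlinarith
  · push Not at hneg
    have hmono : MonotoneOn j (Ici Y) := by
      refine monotoneOn_of_hasDerivWithinAt_nonneg (convex_Ici Y)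
        (fun y hy => (hdj y (hIci y hy)).continuousAt.continuousWithinAt)
        (fun y hy => (hdj y (hIci y (interior_subset hy))).hasDerivWithinAt) fun y hy => ?_
      exact div_nonneg (hneg y (interior_subset hy)) (hIci y (interior_subset hy)).le
    have hanti : AntitoneOn (fun y => p y + j Y / 2 * y) (Ici Y) := by
      have hd : ∀ y ∈ Ici Y, HasDerivAt (fun y => p y + j Y / 2 * y)
          ((a ^ 2 / 4 / y - 1) * j y + j Y / 2 * 1) y :=
        fun y hy => (hdp y (hIci y hy)).add ((hasDerivAt_id y).const_mul _)
      refine antitoneOn_of_hasDerivWithinAt_nonpos (convex_Ici Y)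
        (fun y hy => (hd y hy).continuousAt.continuousWithinAt)
        (fun y hy => (hd y (interior_subset hy)).hasDerivWithinAt) fun y hy => ?_
      have hy' : y ∈ Ici Y := interior_subset hy
      linarith [hdp' y hy', hmono self_mem_Ici hy' hy']
    have hjY := hjpos Y hY
    have hpY := hneg Y self_mem_Ici
    -- Chosen so that the bound p Y - (j Y / 2) s at Y + s equals -1/2.
    set s : ℝ := (2 * p Y + 1) / j Y with hs
    have hs0 : 0 < s := by positivity
    have hle : Y ≤ Y + s := by linarith
    have h2 := hanti self_mem_Ici (mem_Ici.2 hle) hle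
    simp only at h2
    have h3 : j Y * s = 2 * p Y + 1 := by rw [hs]; field_simp
    have h4 := hneg (Y + s) hle
    nlinarith

theorem besselE_pos_near_zero {a : ℝ} (ha : 0 ≤ a) :
    ∃ δ > 0, ∀ y, 0 ≤ y → y < δ → 0 < besselE a y := by
  have hE0 : 0 < besselE a 0 := by
    rw [besselE_zero]; exact inv_pos.2 (Gamma_pos_of_pos (by linarith))
  obtain ⟨δ, hδ, h⟩ := Metric.eventually_nhds_iff.1
    ((continuous_besselE ha).continuousAt.eventually (lt_mem_nhds hE0))
  exact ⟨δ, hδ, fun y h0 h1 => h (by rwa [dist_zero_right, Real.norm_eq_abs, abs_of_nonneg h0])⟩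

theorem besselJ_eq_zero_iff {a x : ℝ} (hx : 0 < x) :
    besselJ a x = 0 ↔ besselE a (x ^ 2 / 4) = 0 := by
  rw [besselJ_eq hx, mul_eq_zero, or_iff_right (rpow_pos_of_pos (by positivity) _).ne']

theorem isLeast_besselZero {a : ℝ} (ha : 0 ≤ a) :
    IsLeast {x | 0 < x ∧ besselJ a x = 0} (besselZero a) := by
  obtain ⟨δ, hδ, hpos⟩ := besselE_pos_near_zero ha
  -- The condition 0 < x is not closed. As E_a has no zero on [0, δ), it can be replaced by x ≥
  -- √(4δ), which makes the zero set closed and its infimum attained.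
  have heq : {x | 0 < x ∧ besselJ a x = 0} = {x | √(4 * δ) ≤ x ∧ besselE a (x ^ 2 / 4) = 0} := by
    ext x
    simp only [mem_ofPred_eq]
    constructor
    · rintro ⟨hx, h0⟩
      rw [besselJ_eq_zero_iff hx] at h0
      refine ⟨?_, h0⟩
      by_contra! hlt
      rw [Real.lt_sqrt hx.le] at hlt
      exact (hpos (x ^ 2 / 4) (by positivity) (by linarith)).ne' h0
    · rintro ⟨hx, h0⟩
      have hx' : 0 < x := (Real.sqrt_pos.2 (by positivity)).trans_le hx
      exact ⟨hx', (besselJ_eq_zero_iff hx').2 h0⟩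
  have hcl : IsClosed {x | 0 < x ∧ besselJ a x = 0} := by
    rw [heq]
    have hc := continuous_besselE ha
    exact isClosed_Ici.inter (isClosed_eq (f := fun x : ℝ => besselE a (x ^ 2 / 4)) (by fun_prop)
      continuous_const)
  refine hcl.isLeast_csInf ?_ ⟨0, fun x hx => hx.1.le⟩
  obtain ⟨y, hy, h0⟩ := exists_besselE_eq_zero ha
  refine ⟨2 * √y, by positivity, ?_⟩
  rw [besselJ_eq_zero_iff (by positivity), mul_pow, sq_sqrt hy.le, ← h0]
  congr 1; ring

theorem besselZero_pos {a : ℝ} (ha : 0 ≤ a) : 0 < besselZero a := (isLeast_besselZero ha).1.1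

/-- E_a starts at 1/Γ(a+1) > 0, so by the intermediate value theorem a nonpositive value would
produce a zero before the first one. -/
theorem besselE_pos {a : ℝ} (ha : 0 ≤ a) {x : ℝ} (hx0 : 0 ≤ x) (hx : x < besselZero a) :
    0 < besselE a (x ^ 2 / 4) := by
  have hE0 : 0 < besselE a 0 := by
    rw [besselE_zero]; exact inv_pos.2 (Gamma_pos_of_pos (by linarith))
  by_contra! h
  have hc : Continuous fun x : ℝ => besselE a (x ^ 2 / 4) :=
    (continuous_besselE ha).comp (by fun_prop)
  obtain ⟨w, hw, hw0⟩ := intermediate_value_Icc' hx0 hc.continuousOn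
    (⟨h, by simpa using hE0.le⟩ : (0 : ℝ) ∈ Icc (besselE a (x ^ 2 / 4)) (besselE a (0 ^ 2 / 4)))
  simp only at hw0
  rcases hw.1.eq_or_lt with h' | h'
  · rw [← h'] at hw0
    norm_num at hw0
    exact hE0.ne' hw0
  · have := (isLeast_besselZero ha).2 ⟨h', (besselJ_eq_zero_iff h').2 hw0⟩
    linarith [hw.2]

/-- `besselE (a + 1)` is nonnegative up to the first zero of `J_a`. -/
theorem besselE_succ_nonneg {a : ℝ} (ha : 0 ≤ a) {x : ℝ} (hx0 : 0 < x) (hx : x < besselZero a) :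
    0 ≤ besselE (a + 1) (x ^ 2 / 4) := by
  have hcont : Continuous (fun y : ℝ => y ^ (a + 1) * besselE (a + 1) y) :=
    (Real.continuous_rpow_const (by linarith)).mul (continuous_besselE (by linarith))
  -- By the recurrence the derivative of y^(a+1) E_(a+1) is y^a E_a, which is positive before the
  -- first zero; the function itself vanishes at 0.
  have hmono : MonotoneOn (fun y : ℝ => y ^ (a + 1) * besselE (a + 1) y) (Icc 0 (x ^ 2 / 4)) := by
    refine monotoneOn_of_hasDerivWithinAt_nonneg (f' := fun y => y ^ a * besselE a y)
      (convex_Icc _ _) hcont.continuousOn (fun y hy => ?_) fun y hy => ?_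
    · rw [interior_Icc] at hy
      refine HasDerivAt.hasDerivWithinAt ?_
      refine ((Real.hasDerivAt_rpow_const (x := y) (p := a + 1) (Or.inl hy.1.ne')).mul
        (hasDerivAt_besselE (a := a + 1) (by linarith) y)).congr_deriv ?_
      rw [add_sub_cancel_right, rpow_add_one hy.1.ne']
      linear_combination (-y ^ a) * besselE_recurrence ha y
    · rw [interior_Icc] at hy
      have h1 : 2 * √y < besselZero a := by
        refine lt_of_lt_of_le ?_ hx.le
        have : √y < x / 2 := by
          rw [Real.sqrt_lt' (by positivity)]
          linarith [hy.2]
        linarith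
      have h2 := besselE_pos ha (by positivity) h1
      rw [mul_pow, sq_sqrt hy.1.le, show (2 : ℝ) ^ 2 * y / 4 = y by ring] at h2
      exact mul_nonneg (rpow_nonneg hy.1.le _) h2.le
  have hx2 : 0 < x ^ 2 / 4 := by positivity
  have h := hmono (left_mem_Icc.2 hx2.le) (right_mem_Icc.2 hx2.le) hx2.le
  simp only [zero_rpow (by linarith : a + 1 ≠ 0), zero_mul] at h
  exact nonneg_of_mul_nonneg_right h (rpow_pos_of_pos hx2 _)

/-- This is J_a' = (a/x) J_a - J_(a+1), with J_(a+1) expressed through `besselE`. -/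
theorem hasDerivAt_besselJ {a : ℝ} (ha : 0 ≤ a) {x : ℝ} (hx : 0 < x) :
    HasDerivAt (besselJ a) (a / x * besselJ a x -
      x / 2 * ((x / 2) ^ a * besselE (a + 1) (x ^ 2 / 4))) x := by
  have h1 : HasDerivAt (fun x : ℝ => (x / 2) ^ a) (1 / 2 * a * (x / 2) ^ (a - 1)) x :=
    ((hasDerivAt_id x).div_const 2).rpow_const (Or.inl (by simp [hx.ne']))
  have h2 : HasDerivAt (fun x : ℝ => x ^ 2 / 4) (x / 2) x := by
    refine ((hasDerivAt_pow 2 x).div_const 4).congr_deriv ?_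
    push_cast; ring
  have h3 := h1.mul ((hasDerivAt_besselE ha (x ^ 2 / 4)).comp x h2)
  rw [besselJ_eq hx]
  refine (h3.congr_of_eventuallyEq ?_).congr_deriv ?_
  · filter_upwards [lt_mem_nhds hx] with w hw using besselJ_eq hw
  · rw [rpow_sub_one (by positivity)]
    simp only [Function.comp]
    field_simp
    ring

/-! ## The logarithmic derivative of the profile -/

/-- The logarithmic derivative of `bvProfile`. -/
def bvLogDeriv (N : ℕ) (α R r : ℝ) : ℝ :=
  (2 - (N : ℝ)) / (2 * r) + besselZero α / R *
      (deriv (besselJ α) (besselZero α / R * r) / besselJ α (besselZero α / R * r))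

/-- The quotient `besselE (α + 1) / besselE α`, at `(z_α r / R)² / 4`. -/
def bvQuot (α R r : ℝ) : ℝ :=
  besselE (α + 1) ((besselZero α / R * r) ^ 2 / 4) / besselE α ((besselZero α / R * r) ^ 2 / 4)

section Profile

variable {N : ℕ} {α R r : ℝ}

theorem besselZero_mul_lt (hα : 0 ≤ α) (hr : r ∈ Ico 0 R) :
    besselZero α / R * r < besselZero α := by
  have hz := besselZero_pos hα
  have hR : 0 < R := hr.1.trans_lt hr.2
  rw [div_mul_eq_mul_div, div_lt_iff₀ hR]
  exact mul_lt_mul_of_pos_left hr.2 hz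

theorem besselE_scaled_pos (hα : 0 ≤ α) (hr : r ∈ Ico 0 R) :
    0 < besselE α ((besselZero α / R * r) ^ 2 / 4) :=
  besselE_pos hα (mul_nonneg (div_nonneg (besselZero_pos hα).le (hr.1.trans hr.2.le)) hr.1)
    (besselZero_mul_lt hα hr)

theorem besselZero_mul_pos (hα : 0 ≤ α) (hr : r ∈ Ioo 0 R) : 0 < besselZero α / R * r :=
  mul_pos (div_pos (besselZero_pos hα) (hr.1.trans hr.2)) hr.1

theorem besselJ_scaled_pos (hα : 0 ≤ α) (hr : r ∈ Ioo 0 R) :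
    0 < besselJ α (besselZero α / R * r) := by
  have := besselZero_mul_pos hα hr
  rw [besselJ_eq this]
  exact mul_pos (rpow_pos_of_pos (by positivity) _) (besselE_scaled_pos hα ⟨hr.1.le, hr.2⟩)

theorem bvProfile_pos (hα : 0 ≤ α) (hr : r ∈ Ioo 0 R) : 0 < bvProfile N α R r :=
  mul_pos (rpow_pos_of_pos hr.1 _) (besselJ_scaled_pos hα hr)

theorem bvProfile_sq (hr : 0 < r) :
    bvProfile N α R r ^ 2 = besselJ α (besselZero α / R * r) ^ 2 / r ^ ((N : ℝ) - 2) := by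
  rw [bvProfile, mul_pow, ← rpow_natCast, ← rpow_mul hr.le,
    show (2 - (N : ℝ)) / 2 * (2 : ℕ) = -((N : ℝ) - 2) by push_cast; ring, rpow_neg hr.le]
  ring

theorem bvQuot_nonneg (hα : 0 ≤ α) (hr : r ∈ Ioo 0 R) : 0 ≤ bvQuot α R r :=
  div_nonneg (besselE_succ_nonneg hα (besselZero_mul_pos hα hr)
    (besselZero_mul_lt hα ⟨hr.1.le, hr.2⟩)) (besselE_scaled_pos hα ⟨hr.1.le, hr.2⟩).le

theorem continuousOn_bvQuot (hα : 0 ≤ α) : ContinuousOn (bvQuot α R) (Ico 0 R) := by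
  have h0 := continuous_besselE hα
  have h1 := continuous_besselE (a := α + 1) (by linarith)
  refine ContinuousOn.div (by fun_prop) (by fun_prop) fun r hr => (besselE_scaled_pos hα hr).ne'

/-- Isolates the whole singularity at 0 in an explicit multiple of 1/r; the other term involves
`bvQuot`, which is continuous up to r = 0. For 0 ≤ α ≤ (N-2)/2 both terms are nonpositive. -/
theorem bvLogDeriv_eq (hα : 0 ≤ α) (hr : r ∈ Ioo 0 R) :
    bvLogDeriv N α R r = -(((N : ℝ) - 2) / 2 - α) / r -
      (besselZero α / R) ^ 2 / 2 * (r * bvQuot α R r) := by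
  have hk : 0 < besselZero α / R := div_pos (besselZero_pos hα) (hr.1.trans hr.2)
  have hx := besselZero_mul_pos hα hr
  have hE := besselE_scaled_pos hα ⟨hr.1.le, hr.2⟩
  have hr0 := hr.1
  have hp : 0 < (besselZero α / R * r / 2) ^ α := rpow_pos_of_pos (by positivity) _
  rw [bvLogDeriv, (hasDerivAt_besselJ hα hx).deriv, besselJ_eq hx, bvQuot]
  generalize (besselZero α / R * r / 2) ^ α = P at *
  generalize besselE α ((besselZero α / R * r) ^ 2 / 4) = E0 at *
  generalize besselE (α + 1) ((besselZero α / R * r) ^ 2 / 4) = E1 at *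
  generalize besselZero α / R = k at *
  field_simp
  ring

theorem hasDerivAt_bvProfile (hα : 0 ≤ α) (hr : r ∈ Ioo 0 R) :
    HasDerivAt (bvProfile N α R) (bvLogDeriv N α R r * bvProfile N α R r) r := by
  have hx := besselZero_mul_pos hα hr
  have hJ := (hasDerivAt_besselJ hα hx).differentiableAt.hasDerivAt
  have h1 : HasDerivAt (fun r : ℝ => besselZero α / R * r) (besselZero α / R) r := by
    simpa using (hasDerivAt_id r).const_mul (besselZero α / R)
  have h2 := (Real.hasDerivAt_rpow_const (x := r) (p := (2 - (N : ℝ)) / 2)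
    (Or.inl hr.1.ne')).mul (hJ.comp r h1)
  refine h2.congr_deriv ?_
  have hJp := (besselJ_scaled_pos hα hr).ne'
  have hr0 := hr.1.ne'
  rw [rpow_sub_one hr0, bvLogDeriv, bvProfile]
  simp only [Function.comp]
  generalize besselJ α (besselZero α / R * r) = J at *
  generalize besselZero α / R = k at *
  field_simp

theorem hasDerivAt_bvQuot (hα : 0 ≤ α) (hr : r ∈ Ioo 0 R) :
    HasDerivAt (bvQuot α R) (2 / r * ((besselZero α / R * r) ^ 2 / 4 * bvQuot α R r ^ 2 -
      (α + 1) * bvQuot α R r + 1)) r := by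
  have hE := (besselE_scaled_pos hα ⟨hr.1.le, hr.2⟩).ne'
  have hr0 := hr.1.ne'
  have h1 : HasDerivAt (fun r : ℝ => (besselZero α / R * r) ^ 2 / 4)
      ((besselZero α / R) ^ 2 * r / 2) r := by
    refine ((((hasDerivAt_id r).const_mul (besselZero α / R)).pow 2).div_const 4).congr_deriv ?_
    simp only [id]; ring
  have h2 := ((hasDerivAt_besselE (a := α + 1) (by linarith) _).comp r h1).div
    ((hasDerivAt_besselE hα _).comp r h1) hE
  refine h2.congr_deriv ?_
  have hrec := besselE_recurrence hα ((besselZero α / R * r) ^ 2 / 4)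
  simp only [bvQuot, Function.comp]
  generalize besselE α ((besselZero α / R * r) ^ 2 / 4) = E0 at *
  generalize besselE (α + 1) ((besselZero α / R * r) ^ 2 / 4) = E1 at *
  generalize besselE (α + 1 + 1) ((besselZero α / R * r) ^ 2 / 4) = E2 at *
  generalize besselZero α / R = k at *
  -- Twice the recurrence, solved for the E_(α+2) term, which the Riccati form of the derivative
  -- must not contain.
  have : k ^ 2 * r / 2 * r * E2 = 2 * ((α + 1) * E1 - E0) := by linear_combination 2 * hrec
  field_simp
  linear_combination (-(8 * E0)) * this

/-- The Riccati equation satisfied by the logarithmic derivative. -/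
theorem hasDerivAt_bvLogDeriv (hα : 0 ≤ α) (hr : r ∈ Ioo 0 R) :
    HasDerivAt (bvLogDeriv N α R) (-bvLogDeriv N α R r ^ 2 - ((N : ℝ) - 1) / r * bvLogDeriv N α R r -
      besselZero α ^ 2 / R ^ 2 - (((N : ℝ) - 2) ^ 2 / 4 - α ^ 2) / r ^ 2) r := by
  have hr0 := hr.1.ne'
  have h1 := (hasDerivAt_inv hr0).const_mul (-(((N : ℝ) - 2) / 2 - α))
  have h2 := ((hasDerivAt_id r).mul (hasDerivAt_bvQuot hα hr)).const_mul
    ((besselZero α / R) ^ 2 / 2)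
  refine ((h1.sub h2).congr_of_eventuallyEq ?_).congr_deriv ?_
  · filter_upwards [isOpen_Ioo.mem_nhds hr] with w hw
    rw [bvLogDeriv_eq hα hw]
    simp [div_eq_mul_inv]
  · rw [bvLogDeriv_eq hα hr, ← div_pow]
    generalize bvQuot α R r = t
    generalize besselZero α / R = k
    simp only [id]
    field_simp
    ring

theorem bvLogDeriv_nonpos (hα : 0 ≤ α) (hN : α ≤ ((N : ℝ) - 2) / 2) (hr : r ∈ Ioo 0 R) :
    bvLogDeriv N α R r ≤ 0 := by
  rw [bvLogDeriv_eq hα hr]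
  have h1 : 0 ≤ (((N : ℝ) - 2) / 2 - α) / r := div_nonneg (by linarith) hr.1.le
  have h2 : 0 ≤ (besselZero α / R) ^ 2 / 2 * (r * bvQuot α R r) :=
    mul_nonneg (by positivity) (mul_nonneg hr.1.le (bvQuot_nonneg hα hr))
  rw [neg_div]
  linarith

end Profile

/-! ## The radial coordinate of the ball model -/

/-- The geodesic distance to the centre, as a function of the Euclidean norm. -/
def ballDist (s : ℝ) : ℝ := log (1 + s) - log (1 - s)

section BallDist

variable {s : ℝ}

theorem hasDerivAt_ballDist (h0 : 0 ≤ s) (h1 : s < 1) :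
    HasDerivAt ballDist (2 / (1 - s ^ 2)) s :=
  hasDerivAt_logRatio (by linarith) h1

theorem exp_ballDist (h0 : 0 ≤ s) (h1 : s < 1) : exp (ballDist s) = (1 + s) / (1 - s) := by
  rw [ballDist, exp_sub, exp_log (by linarith), exp_log (by linarith)]

theorem sinh_ballDist (h0 : 0 ≤ s) (h1 : s < 1) : sinh (ballDist s) = 2 * s / (1 - s ^ 2) := by
  have h2 : 1 - s ≠ 0 := by linarith
  have h3 : 1 + s ≠ 0 := by linarith
  rw [sinh_eq, exp_neg, exp_ballDist h0 h1, show 1 - s ^ 2 = (1 - s) * (1 + s) by ring]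
  field_simp
  ring

theorem ballDist_strictMonoOn : StrictMonoOn ballDist (Ico 0 1) := fun a ha b hb hab => by
  have h1 : log (1 + a) < log (1 + b) := log_lt_log (by linarith [ha.1]) (by linarith)
  have h2 : log (1 - b) < log (1 - a) := log_lt_log (by linarith [hb.2]) (by linarith)
  simp only [ballDist]
  linarith

theorem ballDist_zero : ballDist 0 = 0 := by simp [ballDist]

theorem ballDist_pos (h0 : 0 < s) (h1 : s < 1) : 0 < ballDist s := by
  rw [← ballDist_zero]
  exact ballDist_strictMonoOn (by simp) ⟨h0.le, h1⟩ h0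

/-- Lets singularities in ρ be bounded by the same powers of the Euclidean norm. -/
theorem le_ballDist (h0 : 0 ≤ s) (h1 : s < 1) : s ≤ ballDist s := by
  have h2 := add_one_le_exp (-s)
  have h3 : log (1 - s) ≤ -s := by
    rw [log_le_iff_le_exp (by linarith)]; linarith
  have h4 : 0 ≤ log (1 + s) := log_nonneg (by linarith)
  rw [ballDist]; linarith

theorem ballDist_tanh (t : ℝ) : ballDist (tanh (t / 2)) = t := by
  have h1 := neg_one_lt_tanh (t / 2)
  have h2 := tanh_lt_one (t / 2)
  rw [ballDist, ← log_div (by linarith) (by linarith), log_ratio_tanh]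

theorem tanh_half_pos {R : ℝ} (hR : 0 < R) : 0 < tanh (R / 2) := by
  rw [tanh_eq_sinh_div_cosh]
  exact div_pos (sinh_pos_iff.2 (by linarith)) (cosh_pos _)

theorem ballDist_lt_iff {R : ℝ} (hR : 0 < R) (h0 : 0 ≤ s) (h1 : s < 1) :
    ballDist s < R ↔ s < tanh (R / 2) := by
  conv_lhs => rw [← ballDist_tanh R]
  exact ballDist_strictMonoOn.lt_iff_lt ⟨h0, h1⟩ ⟨(tanh_half_pos hR).le, tanh_lt_one _⟩

end BallDist

/-! ### Distance, gradient and radial derivative in Euclidean coordinates -/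

section Geometry

variable {N : ℕ}

theorem hypRho_eq_ballDist {x : EuclideanSpace ℝ (Fin N)} (hx : x ∈ Metric.ball 0 1) :
    hypRho x = ballDist ‖x‖ := by
  have h : ‖x‖ < 1 := by simpa using hx
  rw [hypRho_eq hx, log_div (by linarith [norm_nonneg x]) (by linarith), ballDist]

theorem hypBall_eq {R : ℝ} (hR : 0 < R) : hypBall N R = Metric.ball 0 (tanh (R / 2)) := by
  ext x
  simp only [hypBall, mem_ofPred_eq, mem_ball_zero_iff]
  constructor
  · rintro ⟨h1, h2⟩
    rw [hypRho_eq_ballDist (by simpa using h1)] at h2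
    exact (ballDist_lt_iff hR (norm_nonneg x) h1).1 h2
  · intro h
    have h1 := h.trans (tanh_lt_one _)
    refine ⟨h1, ?_⟩
    rw [hypRho_eq_ballDist (by simpa using h1)]
    exact (ballDist_lt_iff hR (norm_nonneg x) h1).2 h

theorem hypPuncturedBall_eq {R : ℝ} (hR : 0 < R) :
    hypPuncturedBall N R = Metric.ball 0 (tanh (R / 2)) \ {0} := by
  rw [← hypBall_eq hR]
  ext x
  simp only [hypBall, hypPuncturedBall, mem_ofPred_eq, Set.mem_sdiff, mem_singleton_iff]
  constructor
  · rintro ⟨h1, h2, h3⟩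
    refine ⟨⟨h1, h3⟩, ?_⟩
    rintro rfl
    rw [hypRho_eq_ballDist h1, norm_zero, ballDist_zero] at h2
    exact h2.false
  · rintro ⟨⟨h1, h3⟩, h2⟩
    refine ⟨h1, ?_, h3⟩
    rw [hypRho_eq_ballDist h1]
    exact ballDist_pos (norm_pos_iff.2 h2) (by simpa using h1)

theorem isOpen_hypPuncturedBall {R : ℝ} (hR : 0 < R) : IsOpen (hypPuncturedBall N R) := by
  rw [hypPuncturedBall_eq hR]
  exact Metric.isOpen_ball.sdiff isClosed_singleton

theorem hypPuncturedBall_ne_zero {R : ℝ} {x : EuclideanSpace ℝ (Fin N)}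
    (hx : x ∈ hypPuncturedBall N R) : x ≠ 0 := by
  rintro rfl
  have h := hx.2.1
  rw [hypRho_eq_ballDist hx.1, norm_zero, ballDist_zero] at h
  exact h.false

variable {x : EuclideanSpace ℝ (Fin N)}

theorem hasFDerivAt_hypRho (hx : x ∈ Metric.ball 0 1) (h0 : x ≠ 0) :
    HasFDerivAt hypRho ((2 / (1 - ‖x‖ ^ 2)) • innerSL ℝ (‖x‖⁻¹ • x)) x := by
  have hx1 : ‖x‖ < 1 := by simpa using hx
  have hn : 0 < ‖x‖ := norm_pos_iff.2 h0
  have h1 : HasFDerivAt (fun y : EuclideanSpace ℝ (Fin N) => ‖y‖) (innerSL ℝ (‖x‖⁻¹ • x)) x := by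
    have h2 := (hasStrictFDerivAt_norm_sq x).hasFDerivAt.sqrt (pow_ne_zero 2 hn.ne')
    simp only [sqrt_sq (norm_nonneg _)] at h2
    refine h2.congr_fderiv ?_
    ext v
    simp
    field_simp
  refine ((hasDerivAt_ballDist hn.le hx1).comp_hasFDerivAt x h1).congr_of_eventuallyEq ?_
  filter_upwards [Metric.isOpen_ball.mem_nhds hx] with y hy using hypRho_eq_ballDist hy

theorem radialDeriv_eq {g : EuclideanSpace ℝ (Fin N) → ℝ} (hx : x ∈ Metric.ball 0 1) (h0 : x ≠ 0)
    (hg : DifferentiableAt ℝ g x) :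
    radialDeriv g x = (1 - ‖x‖ ^ 2) / 2 * fderiv ℝ g x (‖x‖⁻¹ • x) := by
  have hn : 0 < ‖x‖ := norm_pos_iff.2 h0
  have hr := hypRay_hypRho hx
  set u := ‖x‖⁻¹ • x with hu
  set t := hypRho x with ht
  have hun : ‖u‖ = 1 := by rw [hu, norm_smul, norm_inv, norm_norm, inv_mul_cancel₀ hn.ne']
  have htanh : tanh (t / 2) ^ 2 = ‖x‖ ^ 2 := by
    rw [← hr, hypRay, norm_smul, hun, mul_one, Real.norm_eq_abs, sq_abs]
  -- The derivative (1 - tanh²)/2 is the Euclidean speed of the unit speed ray, as |x| = tanh(ρ/2).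
  have hd : HasDerivAt (fun t : ℝ => tanh (t / 2)) ((1 - ‖x‖ ^ 2) / 2) t := by
    have hh : HasDerivAt (fun t : ℝ => t / 2) (1 / 2) t := (hasDerivAt_id t).div_const 2
    have hc := cosh_pos (t / 2)
    have h1 := hh.sinh.div hh.cosh hc.ne'
    simp_rw [tanh_eq_sinh_div_cosh]
    refine h1.congr_deriv ?_
    rw [← htanh, tanh_eq_sinh_div_cosh]
    field_simp
  have hd2 : HasDerivAt (hypRay u) (((1 - ‖x‖ ^ 2) / 2) • u) t := hd.smul_const u
  have hg' : HasFDerivAt g (fderiv ℝ g x) (hypRay u t) := by rw [hr]; exact hg.hasFDerivAt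
  have h := (hg'.comp_hasDerivAt t hd2).deriv
  rw [radialDeriv, ← hu, ← ht]
  simpa [Function.comp_def] using h

theorem hypNorm_hypGrad_sq (g : EuclideanSpace ℝ (Fin N) → ℝ) (hx : x ∈ Metric.ball 0 1) :
    hypNorm x (hypGrad g x) ^ 2 = ((1 - ‖x‖ ^ 2) / 2) ^ 2 * ‖gradient g x‖ ^ 2 := by
  have h1 : ‖x‖ < 1 := by simpa using hx
  have h2 : 0 < 1 - ‖x‖ ^ 2 := by nlinarith [norm_nonneg x]
  rw [hypNorm_eq hx, hypGrad, norm_smul, Real.norm_eq_abs, abs_of_nonneg (by positivity)]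
  field_simp

theorem fderiv_eq_inner_gradient (g : EuclideanSpace ℝ (Fin N) → ℝ)
    (v : EuclideanSpace ℝ (Fin N)) : fderiv ℝ g x v = inner ℝ (gradient g x) v := by
  simp [gradient]

/-- The radial derivative is a component of the gradient. -/
theorem radialDeriv_sq_le {g : EuclideanSpace ℝ (Fin N) → ℝ} (hx : x ∈ Metric.ball 0 1) (h0 : x ≠ 0)
    (hg : DifferentiableAt ℝ g x) : radialDeriv g x ^ 2 ≤ hypNorm x (hypGrad g x) ^ 2 := by
  have hn : 0 < ‖x‖ := norm_pos_iff.2 h0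
  rw [radialDeriv_eq hx h0 hg, hypNorm_hypGrad_sq g hx, mul_pow, fderiv_eq_inner_gradient]
  refine mul_le_mul_of_nonneg_left ?_ (sq_nonneg _)
  rw [← sq_abs]
  refine pow_le_pow_left₀ (abs_nonneg _) ((abs_real_inner_le_norm _ _).trans_eq ?_) 2
  rw [norm_smul, norm_inv, norm_norm, inv_mul_cancel₀ hn.ne', mul_one]

/-! ### The substitution f / φ(ρ) -/

section Quotient

variable {α R : ℝ} {f : EuclideanSpace ℝ (Fin N) → ℝ}

/-- Quotient rule with φ' = ψ φ. After the factor 1/φ is taken out, the profile enters only through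
ψ and only in the direction of dρ. -/
theorem hasFDerivAt_div_bvProfile (hα : 0 ≤ α) (hx : x ∈ hypPuncturedBall N R)
    (hf : DifferentiableAt ℝ f x) :
    HasFDerivAt (fun y => f y / bvProfile N α R (hypRho y))
      ((bvProfile N α R (hypRho x))⁻¹ • (fderiv ℝ f x -
        (bvLogDeriv N α R (hypRho x) * f x * (2 / (1 - ‖x‖ ^ 2))) •
          innerSL ℝ (‖x‖⁻¹ • x))) x := by
  have hr : hypRho x ∈ Ioo 0 R := hx.2
  have hφ := (bvProfile_pos (N := N) hα hr).ne'
  have h1 := ((hasDerivAt_bvProfile (N := N) hα hr).fun_inv hφ).comp_hasFDerivAt x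
    (hasFDerivAt_hypRho hx.1 (hypPuncturedBall_ne_zero hx))
  have h2 := hf.hasFDerivAt.mul h1
  simp only [div_eq_mul_inv]
  refine h2.congr_fderiv ?_
  ext v
  simp only [Function.comp, _root_.add_apply, _root_.sub_apply,
    _root_.smul_apply, smul_eq_mul]
  field_simp
  ring

/-- The weight J_α²/ρ^(N-2) is φ², so it cancels the factor 1/φ² of the squared derivative. -/
theorem radialDeriv_div_bvProfile (hα : 0 ≤ α) (hx : x ∈ hypPuncturedBall N R)
    (hf : DifferentiableAt ℝ f x) :
    besselJ α (besselZero α / R * hypRho x) ^ 2 / hypRho x ^ ((N : ℝ) - 2) *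
        radialDeriv (fun y => f y / bvProfile N α R (hypRho y)) x ^ 2 =
      (radialDeriv f x - bvLogDeriv N α R (hypRho x) * f x) ^ 2 := by
  have hr : hypRho x ∈ Ioo 0 R := hx.2
  have h0 := hypPuncturedBall_ne_zero hx
  have hφ := (bvProfile_pos (N := N) hα hr).ne'
  have hd := hasFDerivAt_div_bvProfile hα hx hf
  have hx1 : ‖x‖ < 1 := by simpa using hx.1
  have hx2 : 1 - ‖x‖ ^ 2 ≠ 0 := by nlinarith [norm_nonneg x]
  have hn : ‖x‖ ≠ 0 := norm_ne_zero_iff.2 h0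
  have hun : inner ℝ (‖x‖⁻¹ • x) (‖x‖⁻¹ • x) = (1 : ℝ) := by
    rw [real_inner_self_eq_norm_sq, norm_smul, norm_inv, norm_norm, inv_mul_cancel₀ hn, one_pow]
  rw [← bvProfile_sq hr.1, radialDeriv_eq hx.1 h0 hd.differentiableAt, radialDeriv_eq hx.1 h0 hf,
    hd.fderiv]
  simp only [_root_.sub_apply, _root_.smul_apply, smul_eq_mul,
    innerSL_apply_apply, hun]
  field_simp

/-- Pythagoras: the angular part |∇f|² - (∂_ρ f)² is untouched, since φ is radial, and the radial
part is shifted by ψ f. -/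
theorem hypNorm_hypGrad_div_bvProfile (hα : 0 ≤ α) (hx : x ∈ hypPuncturedBall N R)
    (hf : DifferentiableAt ℝ f x) :
    besselJ α (besselZero α / R * hypRho x) ^ 2 / hypRho x ^ ((N : ℝ) - 2) *
        hypNorm x (hypGrad (fun y => f y / bvProfile N α R (hypRho y)) x) ^ 2 =
      hypNorm x (hypGrad f x) ^ 2 - radialDeriv f x ^ 2 +
        (radialDeriv f x - bvLogDeriv N α R (hypRho x) * f x) ^ 2 := by
  have hr : hypRho x ∈ Ioo 0 R := hx.2
  have h0 := hypPuncturedBall_ne_zero hx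
  have hφ := (bvProfile_pos (N := N) hα hr).ne'
  have hd := hasFDerivAt_div_bvProfile hα hx hf
  have hx1 : ‖x‖ < 1 := by simpa using hx.1
  have hx2 : 1 - ‖x‖ ^ 2 ≠ 0 := by nlinarith [norm_nonneg x]
  have hn : ‖x‖ ≠ 0 := norm_ne_zero_iff.2 h0
  have hun : ‖‖x‖⁻¹ • x‖ = 1 := by
    rw [norm_smul, norm_inv, norm_norm, inv_mul_cancel₀ hn]
  have hgrad : gradient (fun y => f y / bvProfile N α R (hypRho y)) x =
      (bvProfile N α R (hypRho x))⁻¹ • (gradient f x -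
        (bvLogDeriv N α R (hypRho x) * f x * (2 / (1 - ‖x‖ ^ 2))) • (‖x‖⁻¹ • x)) := by
    refine ext_inner_right ℝ fun v => ?_
    rw [← fderiv_eq_inner_gradient, hd.fderiv, real_inner_smul_left, inner_sub_left,
      real_inner_smul_left, ← fderiv_eq_inner_gradient]
    simp only [_root_.sub_apply, _root_.smul_apply, smul_eq_mul,
      innerSL_apply_apply]
  rw [← bvProfile_sq hr.1, hypNorm_hypGrad_sq _ hx.1, hypNorm_hypGrad_sq _ hx.1,
    radialDeriv_eq hx.1 h0 hf, hgrad, norm_smul, mul_pow, norm_sub_sq_real, norm_inv,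
    Real.norm_eq_abs, inv_pow, sq_abs, norm_smul, hun, real_inner_smul_right,
    fderiv_eq_inner_gradient, mul_one, Real.norm_eq_abs, sq_abs]
  field_simp
  ring

end Quotient

/-! ### The defect as the derivative of a flux -/

/-- The density of the identity for the radial derivative: the difference of the two sides. -/
def bvDefect (N : ℕ) (α R : ℝ) (f : EuclideanSpace ℝ (Fin N) → ℝ)
    (x : EuclideanSpace ℝ (Fin N)) : ℝ :=
  radialDeriv f x ^ 2 - (((N : ℝ) - 2) ^ 2 / 4 - α ^ 2) * (f x ^ 2 / hypRho x ^ 2) -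
    besselZero α ^ 2 / R ^ 2 * f x ^ 2 -
    (radialDeriv f x - bvLogDeriv N α R (hypRho x) * f x) ^ 2 +
    ((N : ℝ) - 1) * (bvKernel N α R (hypRho x) * f x ^ 2)

/-- In polar coordinates the defect is a derivative. -/
theorem hasDerivAt_bvFlux {α R : ℝ} (hα : 0 ≤ α) (hR : 0 < R) (hN : 1 ≤ N)
    {f : EuclideanSpace ℝ (Fin N) → ℝ} {u : EuclideanSpace ℝ (Fin N)} (hu : ‖u‖ = 1) {s : ℝ}
    (hs : s ∈ Ioo 0 (tanh (R / 2))) (hf : DifferentiableAt ℝ f (s • u)) :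
    HasDerivAt (fun s => sinh (ballDist s) ^ (N - 1) * bvLogDeriv N α R (ballDist s) *
        f (s • u) ^ 2)
      (s ^ (N - 1) * ((2 / (1 - s ^ 2)) ^ N * bvDefect N α R f (s • u))) s := by
  have hs0 := hs.1
  have hs1 : s < 1 := hs.2.trans (tanh_lt_one _)
  have hs2 : 1 - s ^ 2 ≠ 0 := by nlinarith
  have hns : ‖s • u‖ = s := by rw [norm_smul, hu, mul_one, Real.norm_eq_abs, abs_of_pos hs0]
  have hball : s • u ∈ Metric.ball (0 : EuclideanSpace ℝ (Fin N)) 1 := by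
    rwa [mem_ball_zero_iff, hns]
  have hρ : hypRho (s • u) = ballDist s := by rw [hypRho_eq_ballDist hball, hns]
  have hr : ballDist s ∈ Ioo 0 R := ⟨ballDist_pos hs0 hs1, (ballDist_lt_iff hR hs0.le hs1).2 hs.2⟩
  have hne : s • u ≠ 0 := by rw [← norm_ne_zero_iff, hns]; exact hs0.ne'
  have hL := hasDerivAt_ballDist hs0.le hs1
  have hψ := (hasDerivAt_bvLogDeriv (N := N) hα hr).comp s hL
  have hg : HasDerivAt (fun s : ℝ => f (s • u)) (fderiv ℝ f (s • u) u) s := by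
    have h1 : HasDerivAt (fun s : ℝ => s • u) u s := by
      simpa using (hasDerivAt_id s).smul_const u
    exact hf.hasFDerivAt.comp_hasDerivAt s h1
  have hrad : radialDeriv f (s • u) = (1 - s ^ 2) / 2 * fderiv ℝ f (s • u) u := by
    rw [radialDeriv_eq hball hne hf, hns, smul_smul, inv_mul_cancel₀ hs0.ne', one_smul]
  have hW : HasDerivAt (fun s => sinh (ballDist s) ^ (N - 1))
      (((N : ℝ) - 1) * (sinh (ballDist s) ^ (N - 1) * (cosh (ballDist s) / sinh (ballDist s))) *
        (2 / (1 - s ^ 2))) s := by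
    have h := hL.sinh.fun_pow (N - 1)
    refine h.congr_deriv ?_
    have hsh : sinh (ballDist s) ≠ 0 := (sinh_pos_iff.2 hr.1).ne'
    rw [Nat.cast_sub hN, Nat.cast_one]
    -- The power rule produces the truncated exponent N - 1 - 1, so N = 1 is treated apart.
    rcases Nat.exists_eq_add_of_le hN with ⟨m, rfl⟩
    rcases m with _ | m
    · simp
    · simp only [Nat.add_sub_cancel_left, pow_succ, Nat.add_sub_cancel]
      field_simp
  have hD := (hW.mul hψ).mul (hg.fun_pow 2)
  refine hD.congr_deriv ?_
  -- The conformal volume density in polar coordinates is sinh^(N-1) ρ · dρ/ds, because sinh ρ =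
  -- 2s/(1 - s²).
  have hpow : s ^ (N - 1) * (2 / (1 - s ^ 2)) ^ N =
      sinh (ballDist s) ^ (N - 1) * (2 / (1 - s ^ 2)) := by
    rw [sinh_ballDist hs0.le hs1]
    rcases Nat.exists_eq_add_of_le hN with ⟨m, rfl⟩
    rw [Nat.add_sub_cancel_left, pow_add, pow_one, show 2 * s / (1 - s ^ 2) =
      s * (2 / (1 - s ^ 2)) by ring, mul_pow]
    ring
  rw [← mul_assoc (s ^ (N - 1)), hpow, bvDefect, hρ, hrad]
  have hK : bvKernel N α R (ballDist s) = bvLogDeriv N α R (ballDist s) *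
    ((ballDist s * cosh (ballDist s) - sinh (ballDist s)) /
      (ballDist s * sinh (ballDist s))) := rfl
  rw [hK]
  have hsh : sinh (ballDist s) ≠ 0 := (sinh_pos_iff.2 hr.1).ne'
  have hr0 := hr.1.ne'
  simp only [Function.comp, Pi.mul_apply]
  generalize bvLogDeriv N α R (ballDist s) = ψ
  generalize cosh (ballDist s) = C at *
  generalize sinh (ballDist s) = S at *
  generalize ballDist s = r at *
  generalize f (s • u) = F
  generalize fderiv ℝ f (s • u) u = F'
  generalize besselZero α ^ 2 / R ^ 2 = Z
  generalize S ^ (N - 1) = W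
  field_simp
  ring

end Geometry

/-! ## Polar coordinates -/

/-- A function whose weighted integrals along all rays vanish has integral zero. -/
theorem integral_eq_zero_of_integral_ray_eq_zero {E : Type*} [NormedAddCommGroup E]
    [NormedSpace ℝ E] [FiniteDimensional ℝ E] [MeasurableSpace E] [BorelSpace E] [Nontrivial E]
    (μ : Measure E) [μ.IsAddHaarMeasure] {F : E → ℝ} (hF : Integrable F μ)
    (h : ∀ u : E, ‖u‖ = 1 →
      ∫ s in Ioi (0 : ℝ), s ^ (Module.finrank ℝ E - 1) * F (s • u) = 0) :
    ∫ x, F x ∂μ = 0 := by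
  set g : Metric.sphere (0 : E) 1 × Ioi (0 : ℝ) → ℝ := fun p => F (p.2.1 • p.1.1) with hg
  have hgF : ∀ x : ({(0)}ᶜ : Set E), g (homeomorphUnitSphereProd E x) = F x := fun x => by
    rw [hg]
    simp only
    rw [← homeomorphUnitSphereProd_symm_apply_coe, Homeomorph.symm_apply_apply]
  have hmp := μ.measurePreserving_homeomorphUnitSphereProd
  have hemb := (homeomorphUnitSphereProd E).measurableEmbedding
  have h1 : ∫ x, F x ∂μ = ∫ p, g p ∂(μ.toSphere.prod
      (Measure.volumeIoiPow (Module.finrank ℝ E - 1))) := by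
    rw [← hmp.integral_comp hemb, ← restrict_compl_singleton (μ := μ) 0,
      ← integral_subtype_comap (measurableSet_singleton _).compl, restrict_compl_singleton]
    exact integral_congr_ae (.of_forall fun x => (hgF x).symm)
  have h2 : Integrable g (μ.toSphere.prod
      (Measure.volumeIoiPow (Module.finrank ℝ E - 1))) := by
    rw [← hmp.integrable_comp_emb hemb]
    rw [← restrict_compl_singleton (μ := μ) 0, ← IntegrableOn,
      integrableOn_iff_comap_subtypeVal (measurableSet_singleton _).compl] at hF
    exact hF.congr (.of_forall fun x => (hgF x).symm)
  rw [h1, integral_prod _ h2]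
  refine integral_eq_zero_of_ae (.of_forall fun u => ?_)
  simp only [Measure.volumeIoiPow, ENNReal.ofReal, Pi.zero_apply]
  rw [integral_withDensity_eq_integral_smul
      ((measurable_subtype_coe.pow_const _).real_toNNReal),
    integral_subtype_comap measurableSet_Ioi
      fun a : ℝ => Real.toNNReal (a ^ (Module.finrank ℝ E - 1)) • F (a • u.1)]
  refine Eq.trans ?_ (h u.1 (by simp))
  refine setIntegral_congr_fun measurableSet_Ioi fun s (hs : 0 < s) => ?_
  rw [NNReal.smul_def, Real.coe_toNNReal _ (pow_nonneg hs.le _), smul_eq_mul]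

/-! ### From hyperbolic volume to Lebesgue measure, and an integrability criterion -/

section HypVolume

variable {N : ℕ} {R : ℝ}

theorem hypVolume_restrict_hypPuncturedBall (hR : 0 < R) :
    (hypVolume N).restrict (hypPuncturedBall N R) =
      (volume.restrict (hypPuncturedBall N R)).withDensity
        fun x => ENNReal.ofReal ((2 / (1 - ‖x‖ ^ 2)) ^ N) := by
  have hm := (isOpen_hypPuncturedBall (N := N) hR).measurableSet
  rw [hypVolume, restrict_withDensity hm, Measure.restrict_restrict hm,
    inter_eq_left.2 fun x hx => hx.1]

theorem measurable_hypDensity :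
    Measurable fun x : EuclideanSpace ℝ (Fin N) => ENNReal.ofReal ((2 / (1 - ‖x‖ ^ 2)) ^ N) := by
  fun_prop

theorem hypDensity_toReal {x : EuclideanSpace ℝ (Fin N)} (hx : x ∈ hypPuncturedBall N R) :
    (ENNReal.ofReal ((2 / (1 - ‖x‖ ^ 2)) ^ N)).toReal = (2 / (1 - ‖x‖ ^ 2)) ^ N := by
  have h : ‖x‖ < 1 := by simpa using hx.1
  have h2 : 0 < 1 - ‖x‖ ^ 2 := by nlinarith [norm_nonneg x]
  exact ENNReal.toReal_ofReal (by positivity)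

theorem integrableOn_hypVolume_iff (hR : 0 < R) {H : EuclideanSpace ℝ (Fin N) → ℝ} :
    IntegrableOn H (hypPuncturedBall N R) (hypVolume N) ↔
      IntegrableOn (fun x => (2 / (1 - ‖x‖ ^ 2)) ^ N * H x) (hypPuncturedBall N R) := by
  rw [IntegrableOn, hypVolume_restrict_hypPuncturedBall hR,
    integrable_withDensity_iff_integrable_smul' measurable_hypDensity (by simp)]
  refine integrableOn_congr_fun (fun x hx => ?_) (isOpen_hypPuncturedBall hR).measurableSet
  rw [hypDensity_toReal hx, smul_eq_mul]

theorem setIntegral_hypVolume (hR : 0 < R) (H : EuclideanSpace ℝ (Fin N) → ℝ) :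
    ∫ x in hypPuncturedBall N R, H x ∂hypVolume N =
      ∫ x in hypPuncturedBall N R, (2 / (1 - ‖x‖ ^ 2)) ^ N * H x := by
  rw [hypVolume_restrict_hypPuncturedBall hR,
    integral_withDensity_eq_integral_toReal_smul measurable_hypDensity (by simp)]
  refine setIntegral_congr_fun (isOpen_hypPuncturedBall hR).measurableSet fun x hx => ?_
  rw [hypDensity_toReal hx, smul_eq_mul]

/-- A continuous function with support away from the boundary and a singularity of order `p < N`
at the centre is integrable. -/
theorem integrableOn_hypVolume_of_bound (hR : 0 < R) {H : EuclideanSpace ℝ (Fin N) → ℝ} {S C : ℝ}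
    {p : ℕ} (hp : p < N) (hc : ContinuousOn H (hypPuncturedBall N R)) (hS0 : 0 ≤ S) (hS : S < 1)
    (hsupp : ∀ x ∈ hypPuncturedBall N R, S < ‖x‖ → H x = 0)
    (hbound : ∀ x ∈ hypPuncturedBall N R, ‖x‖ ≤ S → |H x| ≤ C / ‖x‖ ^ p) :
    IntegrableOn H (hypPuncturedBall N R) (hypVolume N) := by
  have : Nontrivial (EuclideanSpace ℝ (Fin N)) := by
    have : Nonempty (Fin N) := ⟨⟨0, by omega⟩⟩
    infer_instance
  have hm := (isOpen_hypPuncturedBall (N := N) hR).measurableSet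
  rw [integrableOn_hypVolume_iff hR]
  have hS2 : 0 < 1 - S ^ 2 := by nlinarith
  have hnorm : IntegrableOn (fun x : EuclideanSpace ℝ (Fin N) => (2 / (1 - S ^ 2)) ^ N *
      (|C| / ‖x‖ ^ p)) (Metric.ball 0 1) := by
    rw [integrableOn_fun_norm_addHaar volume
      (f := fun y : ℝ => (2 / (1 - S ^ 2)) ^ N * (|C| / y ^ p))]
    have hcont : IntegrableOn (fun y : ℝ => (2 / (1 - S ^ 2)) ^ N * |C| * y ^ (N - 1 - p))
        (Ioo 0 1) :=
      (Continuous.integrableOn_Icc (by fun_prop)).mono_set Ioo_subset_Icc_self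
    refine hcont.congr_fun (fun y hy => ?_) measurableSet_Ioo
    have hy0 := hy.1.ne'
    rw [finrank_euclideanSpace_fin, smul_eq_mul]
    simp only
    -- Since p < N, the polar weight y^(N-1) cancels the singularity and leaves a nonnegative power.
    rw [show N - 1 = (N - 1 - p) + p by omega, pow_add, Nat.add_sub_cancel]
    field_simp
  refine Integrable.mono' (hnorm.mono_set fun x hx => hx.1) ?_ ?_
  · refine ContinuousOn.aestronglyMeasurable (ContinuousOn.mul (ContinuousOn.pow
      (ContinuousOn.div continuousOn_const (by fun_prop) fun x hx => ?_) _) hc) hm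
    have h : ‖x‖ < 1 := by simpa using hx.1
    nlinarith [norm_nonneg x]
  · refine (ae_restrict_iff' hm).2 (.of_forall fun x hx => ?_)
    have hx1 : ‖x‖ < 1 := by simpa using hx.1
    have hx2 : 0 < 1 - ‖x‖ ^ 2 := by nlinarith [norm_nonneg x]
    rcases lt_or_ge S ‖x‖ with h | h
    · rw [hsupp x hx h, mul_zero, norm_zero]
      positivity
    · rw [norm_mul, Real.norm_eq_abs, Real.norm_eq_abs, abs_of_nonneg (by positivity)]
      have h3 : |H x| ≤ |C| / ‖x‖ ^ p := (hbound x hx h).trans (by gcongr; exact le_abs_self C)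
      gcongr

end HypVolume

/-! ## Bounds for the weights -/

theorem sinh_le_mul_cosh {r : ℝ} (hr : 0 ≤ r) : sinh r ≤ r * cosh r := by
  have hd : ∀ x : ℝ, HasDerivAt (fun x => x * cosh x - sinh x) (x * sinh x) x := fun x => by
    refine (((hasDerivAt_id x).mul (hasDerivAt_cosh x)).sub (hasDerivAt_sinh x)).congr_deriv ?_
    simp
  have hmono : MonotoneOn (fun x => x * cosh x - sinh x) (Ici 0) := by
    refine monotoneOn_of_hasDerivWithinAt_nonneg (convex_Ici 0)
      (fun x _ => (hd x).continuousAt.continuousWithinAt) (fun x _ => (hd x).hasDerivWithinAt)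
      fun x hx => ?_
    have hx' : 0 ≤ x := interior_subset hx
    exact mul_nonneg hx' (sinh_nonneg_iff.2 hx')
  have h := hmono self_mem_Ici (mem_Ici.2 hr) hr
  simp only [zero_mul, sinh_zero, sub_zero] at h
  linarith

/-- `coth r - 1 / r` lies between `0` and `1`. -/
theorem cothKernel_mem_Icc {r : ℝ} (hr : 0 < r) :
    (r * cosh r - sinh r) / (r * sinh r) ∈ Icc (0 : ℝ) 1 := by
  have hs : 0 < sinh r := sinh_pos_iff.2 hr
  refine ⟨div_nonneg (by linarith [sinh_le_mul_cosh hr.le]) (by positivity), ?_⟩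
  rw [div_le_one (by positivity)]
  -- The upper bound reduces to r (cosh r - sinh r) = r e^(-r) ≤ r ≤ sinh r.
  have h1 : cosh r - sinh r = exp (-r) := cosh_sub_sinh r
  have h2 : exp (-r) ≤ 1 := exp_le_one_iff.2 (by linarith)
  have h3 : r ≤ sinh r := self_le_sinh_iff.2 hr.le
  nlinarith

section Bounds

variable {N : ℕ} {α R : ℝ}

theorem neg_bvKernel_nonneg (hα₀ : 0 ≤ α) (hα : α ≤ ((N : ℝ) - 2) / 2) {r : ℝ} (hr : r ∈ Ioo 0 R) :
    0 ≤ -(((N : ℝ) - 1) * bvKernel N α R r) := by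
  have h1 := bvLogDeriv_nonpos hα₀ hα hr
  have h2 := (cothKernel_mem_Icc hr.1).1
  have h3 : bvKernel N α R r ≤ 0 := mul_nonpos_of_nonpos_of_nonneg h1 h2
  nlinarith

/-- The order of the singularity of `bvLogDeriv` at the origin. -/
def singOrder (N : ℕ) : ℕ := if N = 2 then 0 else 1

/-- The quotient in `bvLogDeriv_eq` is bounded on the compact interval [0, ρ(S)], which stays short
of R. For N = 2 the hypotheses force α = 0 and the 1/r term disappears; this matters because 1/r² is
not integrable in the plane. -/
theorem exists_bound_bvLogDeriv (hα₀ : 0 ≤ α) (hα : α ≤ ((N : ℝ) - 2) / 2) (hR : 0 < R) {S : ℝ}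
    (hS0 : 0 < S) (hS : S < tanh (R / 2)) :
    ∃ C, 0 ≤ C ∧ ∀ s ∈ Ioc 0 S, |bvLogDeriv N α R (ballDist s)| ≤ C / s ^ singOrder N := by
  have hS1 : S < 1 := hS.trans (tanh_lt_one _)
  have hSR : ballDist S < R := (ballDist_lt_iff hR hS0.le hS1).2 hS
  have hL0 := ballDist_pos hS0 hS1
  obtain ⟨M, hM⟩ := isCompact_Icc.exists_bound_of_continuousOn
    ((continuousOn_bvQuot (R := R) hα₀).mono
      (show Icc 0 (ballDist S) ⊆ Ico 0 R from fun r hr => ⟨hr.1, hr.2.trans_lt hSR⟩))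
  have hM0 : 0 ≤ M := (norm_nonneg _).trans (hM 0 ⟨le_rfl, hL0.le⟩)
  set β : ℝ := ((N : ℝ) - 2) / 2 - α with hβ
  have hβ0 : 0 ≤ β := by linarith
  set K : ℝ := (besselZero α / R) ^ 2 / 2 * (ballDist S * M) with hK
  have hK0 : 0 ≤ K := by positivity
  have hψ : ∀ s ∈ Ioc 0 S, |bvLogDeriv N α R (ballDist s)| ≤ β / s + K := by
    intro s hs
    have hs1 := hs.2.trans_lt hS1
    have hle : ballDist s ≤ ballDist S :=
      ballDist_strictMonoOn.monotoneOn ⟨hs.1.le, hs1⟩ ⟨hS0.le, hS1⟩ hs.2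
    have hpos := ballDist_pos hs.1 hs1
    have hq := hM _ ⟨hpos.le, hle⟩
    rw [Real.norm_eq_abs] at hq
    rw [bvLogDeriv_eq hα₀ ⟨hpos, hle.trans_lt hSR⟩, ← hβ]
    refine (abs_sub _ _).trans (add_le_add ?_ ?_)
    · rw [abs_div, abs_neg, abs_of_nonneg hβ0, abs_of_pos hpos]
      exact div_le_div_of_nonneg_left hβ0 hs.1 (le_ballDist hs.1.le hs1)
    · rw [abs_mul, abs_mul, abs_of_nonneg (by positivity), abs_of_pos hpos, hK]
      gcongr
  rcases eq_or_ne N 2 with h2 | h2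
  · refine ⟨K, hK0, fun s hs => (hψ s hs).trans ?_⟩
    have : β = 0 := by
      have h3 : (N : ℝ) = 2 := by exact_mod_cast h2
      rw [hβ, h3]; rw [h3] at hα; linarith
    simp [singOrder, h2, this]
  · refine ⟨β + K, by positivity, fun s hs => (hψ s hs).trans ?_⟩
    simp only [singOrder, h2, if_false, pow_one]
    have hs0 := hs.1
    rw [add_div]
    gcongr
    rw [le_div_iff₀ hs0]
    nlinarith [hs.2]

end Bounds

/-! ### Integrability for a compactly supported f -/

section TestFunction

variable {N : ℕ} {α R : ℝ} {f : EuclideanSpace ℝ (Fin N) → ℝ}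

theorem exists_norm_le_of_tsupport_subset (hR : 0 < R) (hfc : HasCompactSupport f)
    (hfs : tsupport f ⊆ hypBall N R) :
    ∃ S, 0 < S ∧ S < tanh (R / 2) ∧ ∀ x, S < ‖x‖ → x ∉ tsupport f := by
  rw [hypBall_eq hR] at hfs
  have hT := tanh_half_pos hR
  rcases (tsupport f).eq_empty_or_nonempty with he | hne
  · exact ⟨tanh (R / 2) / 2, by linarith, by linarith, by simp [he]⟩
  · obtain ⟨x₀, hx₀, hmax⟩ := hfc.isCompact.exists_isMaxOn hne continuous_norm.continuousOn
    -- The maximum keeps the radius positive even if x₀ = 0.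
    refine ⟨max ‖x₀‖ (tanh (R / 2) / 2), lt_max_of_lt_right (by linarith),
      max_lt (by simpa using hfs hx₀) (by linarith), fun x hx hxs => ?_⟩
    exact absurd (hmax hxs) (not_le.2 ((le_max_left _ _).trans_lt hx))

theorem norm_gradient (x : EuclideanSpace ℝ (Fin N)) : ‖gradient f x‖ = ‖fderiv ℝ f x‖ := by
  simp [gradient]

theorem continuousOn_hypRho : ContinuousOn hypRho (hypPuncturedBall N R) := fun _ hx =>
  (hasFDerivAt_hypRho hx.1 (hypPuncturedBall_ne_zero hx)).continuousAt.continuousWithinAt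

theorem continuousOn_radialDeriv (hf : ContDiff ℝ 1 f) :
    ContinuousOn (radialDeriv f) (hypPuncturedBall N R) := by
  have hc := hf.continuous_fderiv one_ne_zero
  have h : ContinuousOn (fun x => (1 - ‖x‖ ^ 2) / 2 * fderiv ℝ f x (‖x‖⁻¹ • x))
      (hypPuncturedBall N R) := by
    refine ContinuousOn.mul (by fun_prop) (hc.continuousOn.clm_apply ?_)
    exact ContinuousOn.smul (continuous_norm.continuousOn.inv₀ fun x hx =>
      norm_ne_zero_iff.2 (hypPuncturedBall_ne_zero hx)) continuousOn_id
  exact h.congr fun x hx => radialDeriv_eq hx.1 (hypPuncturedBall_ne_zero hx)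
    (hf.differentiable one_ne_zero x)

theorem continuousOn_hypNorm_hypGrad_sq (hf : ContDiff ℝ 1 f) :
    ContinuousOn (fun x => hypNorm x (hypGrad f x) ^ 2) (hypPuncturedBall N R) := by
  have hc := hf.continuous_fderiv one_ne_zero
  have h : ContinuousOn (fun x => ((1 - ‖x‖ ^ 2) / 2) ^ 2 * ‖fderiv ℝ f x‖ ^ 2)
      (hypPuncturedBall N R) := by fun_prop
  exact h.congr fun x hx => by simp only; rw [hypNorm_hypGrad_sq f hx.1, norm_gradient]

theorem continuousOn_bvLogDeriv_hypRho (hα : 0 ≤ α) :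
    ContinuousOn (fun x => bvLogDeriv N α R (hypRho x)) (hypPuncturedBall N R) := by
  have h : ContinuousOn (bvLogDeriv N α R) (Ioo 0 R) := fun r hr =>
    (hasDerivAt_bvLogDeriv hα hr).continuousAt.continuousWithinAt
  exact h.comp continuousOn_hypRho fun x hx => hx.2

theorem continuousOn_bvKernel_hypRho (hα : 0 ≤ α) :
    ContinuousOn (fun x => bvKernel N α R (hypRho x)) (hypPuncturedBall N R) := by
  have h : ContinuousOn (fun r : ℝ => (r * cosh r - sinh r) / (r * sinh r)) (Ioo 0 R) := by
    refine ContinuousOn.div (by fun_prop) (by fun_prop) fun r hr => ?_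
    exact mul_ne_zero hr.1.ne' (sinh_pos_iff.2 hr.1).ne'
  exact (continuousOn_bvLogDeriv_hypRho hα).mul (h.comp continuousOn_hypRho fun x hx => hx.2)

/-- The bounds on a test function, on its derivative and on the weights of the identity. -/
structure TestBounds (N : ℕ) (α R : ℝ) (f : EuclideanSpace ℝ (Fin N) → ℝ) (S C : ℝ) : Prop where
  pos : 0 < S
  lt : S < tanh (R / 2)
  nonneg : 0 ≤ C
  eq_zero : ∀ x, S < ‖x‖ → f x = 0
  fderiv_eq_zero : ∀ x, S < ‖x‖ → fderiv ℝ f x = 0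
  abs_le : ∀ x, |f x| ≤ C
  norm_fderiv_le : ∀ x, ‖fderiv ℝ f x‖ ≤ C
  abs_bvLogDeriv_le : ∀ s ∈ Ioc 0 S, |bvLogDeriv N α R (ballDist s)| ≤ C / s ^ singOrder N

theorem exists_testBounds (hα₀ : 0 ≤ α) (hα : α ≤ ((N : ℝ) - 2) / 2) (hR : 0 < R)
    (hf : ContDiff ℝ 1 f) (hfc : HasCompactSupport f) (hfs : tsupport f ⊆ hypBall N R) :
    ∃ S C, TestBounds N α R f S C := by
  obtain ⟨S, hS0, hS, hsupp⟩ := exists_norm_le_of_tsupport_subset hR hfc hfs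
  obtain ⟨C₁, h₁⟩ := hfc.exists_bound_of_continuous hf.continuous
  obtain ⟨C₂, h₂⟩ := (hfc.fderiv (𝕜 := ℝ)).exists_bound_of_continuous
    (hf.continuous_fderiv one_ne_zero)
  obtain ⟨C₃, hC₃, h₃⟩ := exists_bound_bvLogDeriv hα₀ hα hR hS0 hS
  have hC₁ := (norm_nonneg _).trans (h₁ 0)
  have hC₂ := (norm_nonneg _).trans (h₂ 0)
  refine ⟨S, C₁ + C₂ + C₃, hS0, hS, by positivity,
    fun x hx => image_eq_zero_of_notMem_tsupport (hsupp x hx),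
    fun x hx => fderiv_of_notMem_tsupport ℝ (hsupp x hx),
    fun x => (h₁ x).trans (by linarith), fun x => (h₂ x).trans (by linarith),
    fun s hs => (h₃ s hs).trans ?_⟩
  have hs0 := hs.1
  gcongr
  linarith

namespace TestBounds

variable {S C : ℝ} {x : EuclideanSpace ℝ (Fin N)}

theorem lt_one (h : TestBounds N α R f S C) : S < 1 := h.lt.trans (tanh_lt_one _)

theorem hypNorm_hypGrad_sq_eq_zero (h : TestBounds N α R f S C) (hx : x ∈ hypPuncturedBall N R)
    (hxS : S < ‖x‖) : hypNorm x (hypGrad f x) ^ 2 = 0 := by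
  rw [hypNorm_hypGrad_sq f hx.1, norm_gradient, h.fderiv_eq_zero x hxS]
  simp

theorem hypNorm_hypGrad_sq_le (h : TestBounds N α R f S C) (hx : x ∈ hypPuncturedBall N R) :
    hypNorm x (hypGrad f x) ^ 2 ≤ C ^ 2 := by
  have h1 : ‖x‖ < 1 := by simpa using hx.1
  have h2 : 0 < 1 - ‖x‖ ^ 2 := by nlinarith [norm_nonneg x]
  rw [hypNorm_hypGrad_sq f hx.1, norm_gradient, ← mul_pow]
  refine pow_le_pow_left₀ (by positivity) ?_ 2
  calc (1 - ‖x‖ ^ 2) / 2 * ‖fderiv ℝ f x‖ ≤ 1 * C := by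
        gcongr
        · nlinarith [sq_nonneg ‖x‖]
        · exact h.norm_fderiv_le x
    _ = C := one_mul C

theorem radialDeriv_eq_zero (h : TestBounds N α R f S C) (hf : Differentiable ℝ f)
    (hx : x ∈ hypPuncturedBall N R) (hxS : S < ‖x‖) : radialDeriv f x = 0 := by
  rw [radialDeriv_eq hx.1 (hypPuncturedBall_ne_zero hx) (hf x), h.fderiv_eq_zero x hxS]
  simp

theorem abs_radialDeriv_le (h : TestBounds N α R f S C) (hf : Differentiable ℝ f)
    (hx : x ∈ hypPuncturedBall N R) : |radialDeriv f x| ≤ C := by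
  refine abs_le_of_sq_le_sq ?_ h.nonneg
  exact (radialDeriv_sq_le hx.1 (hypPuncturedBall_ne_zero hx) (hf x)).trans
    (h.hypNorm_hypGrad_sq_le hx)

theorem abs_bvLogDeriv_hypRho_le (h : TestBounds N α R f S C) (hx : x ∈ hypPuncturedBall N R)
    (hxS : ‖x‖ ≤ S) : |bvLogDeriv N α R (hypRho x)| ≤ C / ‖x‖ ^ singOrder N := by
  rw [hypRho_eq_ballDist hx.1]
  exact h.abs_bvLogDeriv_le _ ⟨norm_pos_iff.2 (hypPuncturedBall_ne_zero hx), hxS⟩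

theorem abs_bvKernel_hypRho_le (h : TestBounds N α R f S C) (hx : x ∈ hypPuncturedBall N R)
    (hxS : ‖x‖ ≤ S) : |bvKernel N α R (hypRho x)| ≤ C / ‖x‖ ^ singOrder N := by
  have h1 := cothKernel_mem_Icc hx.2.1
  have h2 : bvKernel N α R (hypRho x) = bvLogDeriv N α R (hypRho x) *
    ((hypRho x * cosh (hypRho x) - sinh (hypRho x)) / (hypRho x * sinh (hypRho x))) := rfl
  rw [h2, abs_mul, abs_of_nonneg h1.1]
  exact (mul_le_of_le_one_right (abs_nonneg _) h1.2).trans (h.abs_bvLogDeriv_hypRho_le hx hxS)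

theorem integrableOn_grad (h : TestBounds N α R f S C) (hR : 0 < R) (hN : 2 ≤ N)
    (hf : ContDiff ℝ 1 f) : IntegrableOn (fun x => hypNorm x (hypGrad f x) ^ 2)
      (hypPuncturedBall N R) (hypVolume N) := by
  refine integrableOn_hypVolume_of_bound (C := C ^ 2) (p := 0) hR (by omega)
    (continuousOn_hypNorm_hypGrad_sq hf) h.pos.le h.lt_one
    (fun x hx hxS => h.hypNorm_hypGrad_sq_eq_zero hx hxS) fun x hx _ => ?_
  rw [abs_of_nonneg (sq_nonneg _), pow_zero, div_one]
  exact h.hypNorm_hypGrad_sq_le hx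

theorem integrableOn_radialDeriv (h : TestBounds N α R f S C) (hR : 0 < R) (hN : 2 ≤ N)
    (hf : ContDiff ℝ 1 f) : IntegrableOn (fun x => radialDeriv f x ^ 2)
      (hypPuncturedBall N R) (hypVolume N) := by
  refine integrableOn_hypVolume_of_bound (C := C ^ 2) (p := 0) hR (by omega)
    ((continuousOn_radialDeriv hf).pow 2) h.pos.le h.lt_one
    (fun x hx hxS => by
      rw [h.radialDeriv_eq_zero (hf.differentiable one_ne_zero) hx hxS]; simp) fun x hx _ => ?_
  rw [abs_pow, pow_zero, div_one]
  exact pow_le_pow_left₀ (abs_nonneg _)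
    (h.abs_radialDeriv_le (hf.differentiable one_ne_zero) hx) 2

theorem integrableOn_sq (h : TestBounds N α R f S C) (hR : 0 < R) (hN : 2 ≤ N)
    (hf : Continuous f) : IntegrableOn (fun x => f x ^ 2)
      (hypPuncturedBall N R) (hypVolume N) := by
  refine integrableOn_hypVolume_of_bound (C := C ^ 2) (p := 0) hR (by omega)
    (hf.continuousOn.pow 2) h.pos.le h.lt_one
    (fun x hx hxS => by rw [h.eq_zero x hxS]; simp) fun x hx _ => ?_
  rw [abs_pow, pow_zero, div_one]
  exact pow_le_pow_left₀ (abs_nonneg _) (h.abs_le x) 2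

theorem integrableOn_hardy (h : TestBounds N α R f S C) (hR : 0 < R) (hN : 2 < N)
    (hf : Continuous f) : IntegrableOn (fun x => f x ^ 2 / hypRho x ^ 2)
      (hypPuncturedBall N R) (hypVolume N) := by
  refine integrableOn_hypVolume_of_bound (C := C ^ 2) (p := 2) hR hN
    ((hf.continuousOn.pow 2).div (continuousOn_hypRho.pow 2) fun x hx => pow_ne_zero 2 hx.2.1.ne')
    h.pos.le h.lt_one
    (fun x hx hxS => by rw [h.eq_zero x hxS]; simp) fun x hx _ => ?_
  have hn : 0 < ‖x‖ := norm_pos_iff.2 (hypPuncturedBall_ne_zero hx)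
  have hle : ‖x‖ ≤ hypRho x := by
    rw [hypRho_eq_ballDist hx.1]
    exact le_ballDist hn.le (by simpa using hx.1)
  rw [abs_div, abs_pow, abs_of_nonneg (sq_nonneg (hypRho x))]
  have := pow_le_pow_left₀ (abs_nonneg _) (h.abs_le x) 2
  gcongr

/-- The first inequality makes ψ² locally integrable; the second leaves a spare factor s in the flux
at the centre. -/
theorem singOrder_add_lt (hN : 2 ≤ N) : singOrder N * 2 < N ∧ singOrder N < N - 1 := by
  unfold singOrder
  split_ifs <;> omega

theorem integrableOn_remainder (h : TestBounds N α R f S C) (hα : 0 ≤ α) (hR : 0 < R) (hN : 2 ≤ N)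
    (hf : ContDiff ℝ 1 f) :
    IntegrableOn (fun x => (radialDeriv f x - bvLogDeriv N α R (hypRho x) * f x) ^ 2)
      (hypPuncturedBall N R) (hypVolume N) := by
  have hd := hf.differentiable one_ne_zero
  refine integrableOn_hypVolume_of_bound (C := (C + C * C) ^ 2) (p := singOrder N * 2) hR
    (singOrder_add_lt hN).1 (((continuousOn_radialDeriv hf).sub
      ((continuousOn_bvLogDeriv_hypRho hα).mul hf.continuous.continuousOn)).pow 2)
    h.pos.le h.lt_one
    (fun x hx hxS => by
      rw [h.eq_zero x hxS, h.radialDeriv_eq_zero hd hx hxS]; simp) fun x hx hxS => ?_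
  have hn : 0 < ‖x‖ := norm_pos_iff.2 (hypPuncturedBall_ne_zero hx)
  have hC := h.nonneg
  rw [abs_pow, pow_mul, ← div_pow]
  refine pow_le_pow_left₀ (abs_nonneg _) ((abs_sub _ _).trans ?_) 2
  rw [add_div, abs_mul]
  gcongr ?_ + ?_
  · refine (h.abs_radialDeriv_le hd hx).trans ?_
    rw [le_div_iff₀ (by positivity)]
    exact mul_le_of_le_one_right hC (pow_le_one₀ hn.le (hxS.trans h.lt_one.le))
  · rw [mul_div_right_comm]
    have h1 := h.abs_bvLogDeriv_hypRho_le hx hxS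
    have h2 := h.abs_le x
    gcongr

theorem integrableOn_bvKernel (h : TestBounds N α R f S C) (hα : 0 ≤ α) (hR : 0 < R) (hN : 2 ≤ N)
    (hf : Continuous f) :
    IntegrableOn (fun x => bvKernel N α R (hypRho x) * f x ^ 2)
      (hypPuncturedBall N R) (hypVolume N) := by
  have hk := (singOrder_add_lt hN).2
  refine integrableOn_hypVolume_of_bound (C := C * C ^ 2) (p := singOrder N) hR
    (by omega) ((continuousOn_bvKernel_hypRho hα).mul (hf.continuousOn.pow 2))
    h.pos.le h.lt_one
    (fun x hx hxS => by rw [h.eq_zero x hxS]; simp) fun x hx hxS => ?_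
  have hC := h.nonneg
  rw [abs_mul, abs_pow, mul_div_right_comm]
  have h1 := h.abs_bvKernel_hypRho_le hx hxS
  have h2 := h.abs_le x
  gcongr

/-- For N = 2 the function f²/ρ² need not be integrable, but its coefficient is zero, so the product
is kept as one integrand. -/
theorem integrableOn_mul_hardy (h : TestBounds N α R f S C) (hα₀ : 0 ≤ α)
    (hα : α ≤ ((N : ℝ) - 2) / 2) (hR : 0 < R) (hN : 2 ≤ N) (hf : Continuous f) :
    IntegrableOn (fun x => (((N : ℝ) - 2) ^ 2 / 4 - α ^ 2) * (f x ^ 2 / hypRho x ^ 2))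
      (hypPuncturedBall N R) (hypVolume N) := by
  rcases hN.eq_or_lt with h2 | h2
  · have hN2 : (N : ℝ) = 2 := by exact_mod_cast h2.symm
    rw [hN2] at hα
    have : α = 0 := by linarith
    simp [hN2, this]
  · exact (h.integrableOn_hardy hR h2 hf).const_mul _

theorem integrableOn_bvDefect (h : TestBounds N α R f S C) (hα₀ : 0 ≤ α)
    (hα : α ≤ ((N : ℝ) - 2) / 2) (hR : 0 < R) (hN : 2 ≤ N) (hf : ContDiff ℝ 1 f) :
    IntegrableOn (bvDefect N α R f) (hypPuncturedBall N R) (hypVolume N) :=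
  ((((h.integrableOn_radialDeriv hR hN hf).sub
    (h.integrableOn_mul_hardy hα₀ hα hR hN hf.continuous)).sub
    ((h.integrableOn_sq hR hN hf.continuous).const_mul _)).sub
    (h.integrableOn_remainder hα₀ hR hN hf)).add
    ((h.integrableOn_bvKernel hα₀ hR hN hf.continuous).const_mul _)

/-! ### Integration of the defect -/

/-- The flux in polar coordinates vanishes at the centre. -/
theorem continuousWithinAt_bvFlux (h : TestBounds N α R f S C) (hN : 2 ≤ N) (u : EuclideanSpace ℝ (Fin N)) :
    ContinuousWithinAt (fun s => sinh (ballDist s) ^ (N - 1) * bvLogDeriv N α R (ballDist s) *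
        f (s • u) ^ 2) (Ici 0) 0 := by
  obtain ⟨-, hk⟩ := singOrder_add_lt hN
  -- Splits s^(N-1) into a factor that cancels the singularity of ψ, a bounded factor s^m, and one s
  -- that tends to zero.
  obtain ⟨m, hm⟩ : ∃ m, N - 1 = singOrder N + m + 1 := ⟨N - 1 - singOrder N - 1, by omega⟩
  have hC := h.nonneg
  have hS1 := h.lt_one
  have hS0 := h.pos
  have hS2 : 0 < 1 - S ^ 2 := by nlinarith
  set A : ℝ := (2 / (1 - S ^ 2)) ^ (N - 1) * C * C ^ 2 with hA
  have hA0 : 0 ≤ A := by positivity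
  have h0 : sinh (ballDist 0) ^ (N - 1) * bvLogDeriv N α R (ballDist 0) *
      f ((0 : ℝ) • u) ^ 2 = 0 := by
    rw [ballDist_zero, sinh_zero, hm, pow_succ]; simp
  rw [ContinuousWithinAt, h0]
  have hlin : Tendsto (fun s : ℝ => A * s) (𝓝[Ici 0] 0) (𝓝 0) := by
    have : Continuous fun s : ℝ => A * s := by fun_prop
    simpa using (this.tendsto 0).mono_left nhdsWithin_le_nhds
  refine squeeze_zero_norm' ?_ hlin
  filter_upwards [self_mem_nhdsWithin, nhdsWithin_le_nhds (Iic_mem_nhds hS0)] with s hs0 hsS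
  rcases (mem_Ici.1 hs0).eq_or_lt with hz | hpos
  · rw [← hz, h0]; simp
  have hsS' : s ≤ S := hsS
  have hs1 : s < 1 := hsS'.trans_lt hS1
  have h1 := h.abs_bvLogDeriv_le s ⟨hpos, hsS⟩
  have h2 := h.abs_le (s • u)
  have h3 : |sinh (ballDist s)| ≤ 2 / (1 - S ^ 2) * s := by
    have : 0 < 1 - s ^ 2 := by nlinarith
    rw [abs_of_nonneg (sinh_nonneg_iff.2 (ballDist_pos hpos hs1).le),
      sinh_ballDist hpos.le hs1, div_mul_eq_mul_div]
    gcongr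
  rw [norm_mul, norm_mul, norm_pow, norm_pow, Real.norm_eq_abs, Real.norm_eq_abs, Real.norm_eq_abs]
  calc |sinh (ballDist s)| ^ (N - 1) * |bvLogDeriv N α R (ballDist s)| * |f (s • u)| ^ 2
      ≤ (2 / (1 - S ^ 2) * s) ^ (N - 1) * (C / s ^ singOrder N) * C ^ 2 := by gcongr
    _ = A * s * s ^ m := by
      have hs : s ^ (N - 1) = s ^ singOrder N * s ^ m * s := by rw [hm]; ring
      rw [mul_pow, hs, hA]
      field_simp
    _ ≤ A * s * 1 := by gcongr; exact pow_le_one₀ hpos.le hs1.le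
    _ = A * s := mul_one _

/-- Fundamental theorem of calculus on (0, ∞): the flux is zero at the centre and beyond the support
of f. -/
theorem integral_ray_bvDefect (h : TestBounds N α R f S C) (hα : 0 ≤ α) (hR : 0 < R) (hN : 2 ≤ N)
    (hf : Differentiable ℝ f) {u : EuclideanSpace ℝ (Fin N)} (hu : ‖u‖ = 1) :
    ∫ s in Ioi (0 : ℝ), s ^ (N - 1) * (hypPuncturedBall N R).indicator
      (fun x => (2 / (1 - ‖x‖ ^ 2)) ^ N * bvDefect N α R f x) (s • u) = 0 := by
  set G : ℝ → ℝ := fun s => sinh (ballDist s) ^ (N - 1) * bvLogDeriv N α R (ballDist s) *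
        f (s • u) ^ 2 with hG
  have hns : ∀ s : ℝ, 0 < s → ‖s • u‖ = s := fun s hs => by
    rw [norm_smul, hu, mul_one, Real.norm_eq_abs, abs_of_pos hs]
  have hGzero : ∀ s, S < s → G s = 0 := fun s hs => by
    simp only [hG]
    rw [h.eq_zero (s • u) (by rwa [hns s (h.pos.trans hs)])]
    simp
  have hderiv : ∀ s ∈ Ioi (0 : ℝ), HasDerivAt G (s ^ (N - 1) * (hypPuncturedBall N R).indicator
      (fun x => (2 / (1 - ‖x‖ ^ 2)) ^ N * bvDefect N α R f x) (s • u)) s := by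
    intro s hs
    have hs0 : 0 < s := hs
    rcases lt_or_ge s (tanh (R / 2)) with hlt | hge
    · have hmem : s • u ∈ hypPuncturedBall N R := by
        rw [hypPuncturedBall_eq hR]
        refine ⟨by rwa [mem_ball_zero_iff, hns s hs0], ?_⟩
        exact norm_ne_zero_iff.1 ((hns s hs0).trans_ne hs0.ne')
      rw [indicator_of_mem hmem, hns s hs0]
      exact hasDerivAt_bvFlux hα hR (by omega) hu ⟨hs0, hlt⟩ (hf _)
    -- The flux vanishes on all of (S, ∞), a neighbourhood of s because S < tanh(R/2), so the
    -- indicator causes no jump at the boundary.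
    · have hmem : s • u ∉ hypPuncturedBall N R := by
        rw [hypPuncturedBall_eq hR]
        intro hmem
        have := mem_ball_zero_iff.1 hmem.1
        rw [hns s hs0] at this
        exact absurd this (not_lt.2 hge)
      rw [indicator_of_notMem hmem, mul_zero]
      refine (hasDerivAt_const s (0 : ℝ)).congr_of_eventuallyEq ?_
      filter_upwards [Ioi_mem_nhds (h.lt.trans_le hge)] with t ht using hGzero t ht
  have hG0 : G 0 = 0 := by
    simp only [hG]
    rw [ballDist_zero, sinh_zero, zero_pow (by omega)]; simp
  by_cases hint : IntegrableOn (fun s : ℝ => s ^ (N - 1) * (hypPuncturedBall N R).indicator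
      (fun x => (2 / (1 - ‖x‖ ^ 2)) ^ N * bvDefect N α R f x) (s • u)) (Ioi 0)
  · have hlim : Tendsto G atTop (𝓝 0) := by
      refine tendsto_const_nhds.congr' ?_
      filter_upwards [eventually_gt_atTop S] with s hs using (hGzero s hs).symm
    rw [integral_Ioi_of_hasDerivAt_of_tendsto (h.continuousWithinAt_bvFlux hN u) hderiv hint hlim]
    exact sub_eq_zero.2 hG0.symm
  -- A nonintegrable ray has integral 0 by convention, so integrability along single rays need not
  -- be proved.
  · exact integral_undef hint

theorem integral_bvDefect (h : TestBounds N α R f S C) (hα₀ : 0 ≤ α)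
    (hα : α ≤ ((N : ℝ) - 2) / 2) (hR : 0 < R) (hN : 2 ≤ N) (hf : ContDiff ℝ 1 f) :
    ∫ x in hypPuncturedBall N R, bvDefect N α R f x ∂hypVolume N = 0 := by
  have : Nontrivial (EuclideanSpace ℝ (Fin N)) := by
    have : Nonempty (Fin N) := ⟨⟨0, by omega⟩⟩
    infer_instance
  have hm := (isOpen_hypPuncturedBall (N := N) hR).measurableSet
  rw [setIntegral_hypVolume hR, ← integral_indicator hm]
  refine integral_eq_zero_of_integral_ray_eq_zero volume ?_ fun u hu => ?_
  · rw [integrable_indicator_iff hm]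
    exact (integrableOn_hypVolume_iff hR).1 (h.integrableOn_bvDefect hα₀ hα hR hN hf)
  · rw [finrank_euclideanSpace_fin]
    exact h.integral_ray_bvDefect hα₀ hR hN (hf.differentiable one_ne_zero) hu

/-- The identity for the radial derivative. -/
theorem radial_identity (h : TestBounds N α R f S C) (hα₀ : 0 ≤ α)
    (hα : α ≤ ((N : ℝ) - 2) / 2) (hR : 0 < R) (hN : 2 ≤ N) (hf : ContDiff ℝ 1 f) :
    (∫ x in hypPuncturedBall N R, radialDeriv f x ^ 2 ∂hypVolume N) -
        (((N : ℝ) - 2) ^ 2 / 4 - α ^ 2) *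
          ∫ x in hypPuncturedBall N R, f x ^ 2 / hypRho x ^ 2 ∂hypVolume N =
      besselZero α ^ 2 / R ^ 2 * (∫ x in hypPuncturedBall N R, f x ^ 2 ∂hypVolume N) +
      (∫ x in hypPuncturedBall N R,
        (radialDeriv f x - bvLogDeriv N α R (hypRho x) * f x) ^ 2 ∂hypVolume N) -
      ((N : ℝ) - 1) *
        (∫ x in hypPuncturedBall N R, bvKernel N α R (hypRho x) * f x ^ 2 ∂hypVolume N) := by
  have h0 := h.integral_bvDefect hα₀ hα hR hN hf
  have i1 := h.integrableOn_radialDeriv hR hN hf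
  have i2 := h.integrableOn_mul_hardy hα₀ hα hR hN hf.continuous
  have i3 := (h.integrableOn_sq hR hN hf.continuous).const_mul (besselZero α ^ 2 / R ^ 2)
  have i4 := h.integrableOn_remainder hα₀ hR hN hf
  have i5 := (h.integrableOn_bvKernel hα₀ hR hN hf.continuous).const_mul ((N : ℝ) - 1)
  have h1 := integral_add' (((i1.sub i2).sub i3).sub i4) i5
  -- Pulling out the Hardy constant requires no integrability of f²/ρ², so N = 2 is included.
  rw [integral_sub' ((i1.sub i2).sub i3) i4, integral_sub' (i1.sub i2) i3, integral_sub' i1 i2,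
    integral_const_mul, integral_const_mul, integral_const_mul] at h1
  have h2 := h0.symm.trans h1
  linarith

end TestBounds

end TestFunction

end

/-! ### The identities and the chain of inequalities -/

theorem theorem1p5 (N : ℕ) (α : ℝ) (hα₀ : 0 ≤ α) (hα : α ≤ ((N : ℝ) - 2) / 2)
    (R : ℝ) (hR : 0 < R) (f : EuclideanSpace ℝ (Fin N) → ℝ) (hf : ContDiff ℝ ∞ f)
    (hfc : HasCompactSupport f) (hfs : tsupport f ⊆ hypBall N R) :
    -- `z_α` is the first positive zero of `J_α`
    IsLeast {x | 0 < x ∧ besselJ α x = 0} (besselZero α) ∧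
    -- all the integrals are finite
    -- (for `N = 2` the coefficient of the integral of `f² / ρ²` vanishes)
    IntegrableOn (fun x => hypNorm x (hypGrad f x) ^ 2) (hypPuncturedBall N R) (hypVolume N) ∧
    IntegrableOn (fun x => radialDeriv f x ^ 2) (hypPuncturedBall N R) (hypVolume N) ∧
    IntegrableOn (fun x => f x ^ 2) (hypPuncturedBall N R) (hypVolume N) ∧
    (2 < N → IntegrableOn (fun x => f x ^ 2 / hypRho x ^ 2)
      (hypPuncturedBall N R) (hypVolume N)) ∧
    IntegrableOn (fun x => besselJ α (besselZero α / R * hypRho x) ^ 2 / hypRho x ^ ((N : ℝ) - 2) *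
        hypNorm x (hypGrad (fun y => f y / bvProfile N α R (hypRho y)) x) ^ 2)
      (hypPuncturedBall N R) (hypVolume N) ∧
    IntegrableOn (fun x => besselJ α (besselZero α / R * hypRho x) ^ 2 / hypRho x ^ ((N : ℝ) - 2) *
        radialDeriv (fun y => f y / bvProfile N α R (hypRho y)) x ^ 2)
      (hypPuncturedBall N R) (hypVolume N) ∧
    IntegrableOn (fun x => bvKernel N α R (hypRho x) * f x ^ 2)
      (hypPuncturedBall N R) (hypVolume N) ∧
    -- the identity for the gradient
    (∫ x in hypPuncturedBall N R, hypNorm x (hypGrad f x) ^ 2 ∂hypVolume N) -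
        (((N : ℝ) - 2) ^ 2 / 4 - α ^ 2) *
          ∫ x in hypPuncturedBall N R, f x ^ 2 / hypRho x ^ 2 ∂hypVolume N =
      besselZero α ^ 2 / R ^ 2 * (∫ x in hypPuncturedBall N R, f x ^ 2 ∂hypVolume N) +
      (∫ x in hypPuncturedBall N R,
        besselJ α (besselZero α / R * hypRho x) ^ 2 / hypRho x ^ ((N : ℝ) - 2) *
          hypNorm x (hypGrad (fun y => f y / bvProfile N α R (hypRho y)) x) ^ 2 ∂hypVolume N) -
      ((N : ℝ) - 1) * (∫ x in hypPuncturedBall N R, bvKernel N α R (hypRho x) * f x ^ 2 ∂hypVolume N) ∧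
    -- the identity for the radial derivative
    (∫ x in hypPuncturedBall N R, radialDeriv f x ^ 2 ∂hypVolume N) -
        (((N : ℝ) - 2) ^ 2 / 4 - α ^ 2) *
          ∫ x in hypPuncturedBall N R, f x ^ 2 / hypRho x ^ 2 ∂hypVolume N =
      besselZero α ^ 2 / R ^ 2 * (∫ x in hypPuncturedBall N R, f x ^ 2 ∂hypVolume N) +
      (∫ x in hypPuncturedBall N R,
        besselJ α (besselZero α / R * hypRho x) ^ 2 / hypRho x ^ ((N : ℝ) - 2) *
          radialDeriv (fun y => f y / bvProfile N α R (hypRho y)) x ^ 2 ∂hypVolume N) -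
      ((N : ℝ) - 1) * (∫ x in hypPuncturedBall N R, bvKernel N α R (hypRho x) * f x ^ 2 ∂hypVolume N) ∧
    -- the integrand of the last term is nonnegative
    (∀ r ∈ Ioo 0 R, 0 ≤ -(((N : ℝ) - 1) * bvKernel N α R r)) ∧
    -- the chain of inequalities
    (∫ x in hypPuncturedBall N R, radialDeriv f x ^ 2 ∂hypVolume N) ≤
      (∫ x in hypPuncturedBall N R, hypNorm x (hypGrad f x) ^ 2 ∂hypVolume N) ∧
    (((N : ℝ) - 2) ^ 2 / 4 - α ^ 2) *
          (∫ x in hypPuncturedBall N R, f x ^ 2 / hypRho x ^ 2 ∂hypVolume N) +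
        besselZero α ^ 2 / R ^ 2 * (∫ x in hypPuncturedBall N R, f x ^ 2 ∂hypVolume N) -
        ((N : ℝ) - 1) * (∫ x in hypPuncturedBall N R, bvKernel N α R (hypRho x) * f x ^ 2 ∂hypVolume N) ≤
      (∫ x in hypPuncturedBall N R, radialDeriv f x ^ 2 ∂hypVolume N) ∧
    (((N : ℝ) - 2) ^ 2 / 4 - α ^ 2) *
          (∫ x in hypPuncturedBall N R, f x ^ 2 / hypRho x ^ 2 ∂hypVolume N) +
        besselZero α ^ 2 / R ^ 2 * (∫ x in hypPuncturedBall N R, f x ^ 2 ∂hypVolume N) ≤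
      (((N : ℝ) - 2) ^ 2 / 4 - α ^ 2) *
          (∫ x in hypPuncturedBall N R, f x ^ 2 / hypRho x ^ 2 ∂hypVolume N) +
        besselZero α ^ 2 / R ^ 2 * (∫ x in hypPuncturedBall N R, f x ^ 2 ∂hypVolume N) -
        ((N : ℝ) - 1) * (∫ x in hypPuncturedBall N R, bvKernel N α R (hypRho x) * f x ^ 2 ∂hypVolume N) := by
  have hN : 2 ≤ N := by
    have : (2 : ℝ) ≤ N := by linarith
    exact_mod_cast this
  have hf₁ : ContDiff ℝ 1 f := hf.of_le (by exact_mod_cast le_top)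
  have hd : Differentiable ℝ f := hf₁.differentiable one_ne_zero
  have hm := (isOpen_hypPuncturedBall (N := N) hR).measurableSet
  obtain ⟨S, C, h⟩ := exists_testBounds hα₀ hα hR hf₁ hfc hfs
  have igrad := h.integrableOn_grad hR hN hf₁
  have irad := h.integrableOn_radialDeriv hR hN hf₁
  have irem := h.integrableOn_remainder hα₀ hR hN hf₁
  have iker := h.integrableOn_bvKernel hα₀ hR hN hf.continuous
  have eqrad : EqOn (fun x => besselJ α (besselZero α / R * hypRho x) ^ 2 /
        hypRho x ^ ((N : ℝ) - 2) *
          radialDeriv (fun y => f y / bvProfile N α R (hypRho y)) x ^ 2)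
      (fun x => (radialDeriv f x - bvLogDeriv N α R (hypRho x) * f x) ^ 2)
      (hypPuncturedBall N R) := fun x hx => radialDeriv_div_bvProfile hα₀ hx (hd x)
  have eqgrad : EqOn (fun x => besselJ α (besselZero α / R * hypRho x) ^ 2 /
        hypRho x ^ ((N : ℝ) - 2) *
          hypNorm x (hypGrad (fun y => f y / bvProfile N α R (hypRho y)) x) ^ 2)
      (fun x => hypNorm x (hypGrad f x) ^ 2 - radialDeriv f x ^ 2 +
        (radialDeriv f x - bvLogDeriv N α R (hypRho x) * f x) ^ 2)
      (hypPuncturedBall N R) := fun x hx => hypNorm_hypGrad_div_bvProfile hα₀ hx (hd x)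
  have hrad := h.radial_identity hα₀ hα hR hN hf₁
  have hsign : ∀ r ∈ Ioo 0 R, 0 ≤ -(((N : ℝ) - 1) * bvKernel N α R r) := fun r hr =>
    neg_bvKernel_nonneg hα₀ hα hr
  have hrem : 0 ≤ ∫ x in hypPuncturedBall N R,
      (radialDeriv f x - bvLogDeriv N α R (hypRho x) * f x) ^ 2 ∂hypVolume N :=
    integral_nonneg fun x => sq_nonneg _
  have hker : ((N : ℝ) - 1) *
      (∫ x in hypPuncturedBall N R, bvKernel N α R (hypRho x) * f x ^ 2 ∂hypVolume N) ≤ 0 := by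
    rw [← integral_const_mul]
    refine setIntegral_nonpos hm fun x hx => ?_
    rw [← mul_assoc]
    exact mul_nonpos_of_nonpos_of_nonneg (by linarith [hsign _ hx.2]) (sq_nonneg _)
  refine ⟨isLeast_besselZero hα₀, igrad, irad, h.integrableOn_sq hR hN hf.continuous,
    fun hN' => h.integrableOn_hardy hR hN' hf.continuous,
    ((igrad.sub irad).add irem).congr_fun eqgrad.symm hm,
    irem.congr_fun eqrad.symm hm, iker, ?_, ?_, hsign, ?_, ?_, ?_⟩
  -- The weighted gradient term is the radial remainder plus ∫|∇f|² - ∫(∂_ρ f)²; adding that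
  -- difference to the radial identity gives the gradient one.
  · have hsplit := integral_add' (igrad.sub irad) irem
    rw [integral_sub' igrad irad] at hsplit
    have hgrad := (setIntegral_congr_fun hm eqgrad).trans hsplit
    linarith
  · rw [setIntegral_congr_fun hm eqrad]
    exact hrad
  · exact setIntegral_mono_on irad igrad hm fun x hx =>
      radialDeriv_sq_le hx.1 (hypPuncturedBall_ne_zero hx) (hd x)
  · linarith
  · linarith
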